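/- **Definitions.** Games are short normal-play combinatorial games, $G=\{G^{\mathcal L}\mid G^{\mathcal R}\}$, and a *dyadic* is a rational number $k/2^m$, identified with its canonical-form game. The Left and Right stops of $G$ are $\ell(G)=r(G)=x$ if $G$ equals a dyadic $x$, and otherwise $\ell(G)=\max_{G^L} r(G^L)$ and $r(G)=\min_{G^R}\ell(G^R)$. For $G$ in canonical form and a dyadic $p\ge 0$, the game $G$ *penalized by* $p$ is defined recursively by $G_p=\{G^{\mathcal L}{}_p-p\mid G^{\mathcal R}{}_p+p\}$ for $0\le p\le t$, where $t$ is the smallest $p\geq 0$ at which the two stops of this game are equal, say to $x$; and $G_p=x$ for $p>t$. The *temperature* $t(G)$ of a game that is not equal to a dyadic is the smallest dyadic $p\ge 0$ with $\ell(G_p)=r(G_p)$; the temperature of a dyadic $k/2^m$ in lowest terms is $-1/2^m$. The *thermograph* of $G$ is the plot of $\ell(G_p)$ and $r(G_p)$ (horizontal coordinate) against $p$ (vertical coordinate); its small left and right walls are the sets of points $(\ell(G_p),p)$, respectively $(r(G_p),p)$, with $p$ dyadic and $0\le p\le t(G)$. A wall has slope $k$ if, for some constant $c$, all its points $(x,p)$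 satisfy $x=kp+c$ (so a wall of slope $0$ is vertical). A game $G$ with $t(G)\ge 0$ is a * *double tent* if its small left wall has slope $-1$ and its small right wall has slope $+1$; * *left single tent* if its small left wall has slope $-1$ and its small right wall has slope $0$; * *right single tent* if its small left wall has slope $0$ and its small right wall has slope $+1$. For integers $n,a,b\ge 0$, the Little John position $(n;a,b)^*$ is the following game. If $n=0$ or $a=b=0$, neither player has an option. Otherwise, if $a,b>0$, put $\gamma=\min\{n,a,b\}$; the only Left option is $(n-\gamma;a,b-\gamma)^*$ and the only Right option is $(n-\gamma;a-\gamma,b)^*$. If $a>0=b$, the only Left option is $(n-1;a,0)^*$ and Right has no option; if $b>0=a$, the only Right option is $(n-1;0,b)^*$ and Left has no option. **Theorem (Little John Thermographs).** Let $a,b>0$ be fixed integers, let $\phi=\frac{1+\sqrt5}{2}$, and let $G=(n;a,b)^*$. Then, for all sufficiently large $n$ (depending on $a$ and $b$), 1. $G$ is a left single tent if $\frac ab>\phi$; 2. $G$ is a right single tent if $\frac ab<\phi^{-1}$; 3. $G$ is a double tent otherwise. -/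

import Mathlib

/-- The ring `𝔻` of dyadic rationals `k / 2 ^ n`. -/
def dyadicRationals : Subring ℚ where
  carrier := {q | ∃ (k : ℤ) (n : ℕ), q = k / 2 ^ n}
  mul_mem' := by
    rintro _ _ ⟨k, n, rfl⟩ ⟨k', n', rfl⟩
    exact ⟨k * k', n + n', by push_cast; rw [pow_add]; field_simp⟩
  one_mem' := ⟨1, 0, by simp⟩
  add_mem' := by
    rintro _ _ ⟨k, n, rfl⟩ ⟨k', n', rfl⟩
    exact ⟨k * 2 ^ n' + k' * 2 ^ n, n + n', by push_cast; rw [pow_add]; field_simp⟩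
  zero_mem' := ⟨0, 0, by simp⟩
  neg_mem' := by
    rintro _ ⟨k, n, rfl⟩
    exact ⟨-k, n, by push_cast; ring⟩

/-- Short (normal play, partizan) games in literal form: finitely many Left options `L i`
and finitely many Right options `R j`. -/
inductive ShortGame : Type
  | mk (l r : ℕ) (L : Fin l → ShortGame) (R : Fin r → ShortGame) : ShortGame

namespace ShortGame

/-- The number of Left options. -/
def numLeft : ShortGame → ℕ
  | mk l _ _ _ => l

/-- The number of Right options. -/
def numRight : ShortGame → ℕ
  | mk _ r _ _ => r

/-- The Left options. -/
def left : (G : ShortGame) → Fin G.numLeft → ShortGame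
  | mk _ _ L _ => L

/-- The Right options. -/
def right : (G : ShortGame) → Fin G.numRight → ShortGame
  | mk _ _ _ R => R

/-- The height of the game tree; it is used only for termination proofs. -/
def height : ShortGame → ℕ
  | mk _ _ L R =>
    max (Finset.univ.sup fun i => height (L i)) (Finset.univ.sup fun j => height (R j)) + 1

theorem height_left_lt : ∀ (G : ShortGame) (i : Fin G.numLeft), (G.left i).height < G.height
  | mk _ _ L _, i => by
    have h := Finset.le_sup (f := fun i => height (L i)) (Finset.mem_univ i)
    simp only [left, height]
    exact Nat.lt_succ_of_le (le_max_of_le_left h)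

theorem height_right_lt : ∀ (G : ShortGame) (j : Fin G.numRight), (G.right j).height < G.height
  | mk _ _ _ R, j => by
    have h := Finset.le_sup (f := fun j => height (R j)) (Finset.mem_univ j)
    simp only [right, height]
    exact Nat.lt_succ_of_le (le_max_of_le_right h)

/-- The game `{∅ | ∅}`. -/
instance : Zero ShortGame := ⟨mk 0 0 ![] ![]⟩

/-- The game `{G | H}` with one option for each player. -/
def switch (G H : ShortGame) : ShortGame := mk 1 1 ![G] ![H]

/-- The negative of a game: the roles of the players are exchanged. -/
def neg : ShortGame → ShortGame
  | mk l r L R => mk r l (fun j => neg (R j)) (fun i => neg (L i))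

instance : Neg ShortGame := ⟨neg⟩

/-- The disjunctive sum `{G^L + H, G + H^L | G^R + H, G + H^R}`. -/
def add (G H : ShortGame) : ShortGame :=
  mk (G.numLeft + H.numLeft) (G.numRight + H.numRight)
    (Fin.append (fun i => add (G.left i) H) (fun i => add G (H.left i)))
    (Fin.append (fun j => add (G.right j) H) (fun j => add G (H.right j)))
termination_by G.height + H.height
decreasing_by
  · have := height_left_lt G i; omega
  · have := height_left_lt H i; omega
  · have := height_right_lt G j; omega
  · have := height_right_lt H j; omega

instance : Add ShortGame := ⟨add⟩

instance : Sub ShortGame := ⟨fun G H => G + -H⟩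

/-- The order of games: `G ≤ H` if and only if no `G^L` satisfies `H ≤ G^L` and no `H^R` satisfies
`H^R ≤ G`. -/
def le (G H : ShortGame) : Prop :=
  (∀ i, ¬ le H (G.left i)) ∧ (∀ j, ¬ le (H.right j) G)
termination_by G.height + H.height
decreasing_by
  · have := height_left_lt G i; omega
  · have := height_right_lt H j; omega

instance : LE ShortGame := ⟨le⟩

/-- Equality of game values: `G = H` in the sense of combinatorial game theory. -/
def Equal (G H : ShortGame) : Prop := G ≤ H ∧ H ≤ G

/-- The canonical form of a nonnegative integer, `k + 1 = {k | ∅}`. -/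
def ofNat : ℕ → ShortGame
  | 0 => 0
  | k + 1 => mk 1 0 ![ofNat k] ![]

/-- The canonical form of an integer, `k + 1 = {k | ∅}` and `-(k + 1) = {∅ | -k}` for `k ≥ 0`. -/
def ofInt : ℤ → ShortGame
  | Int.ofNat k => ofNat k
  | Int.negSucc k => -ofNat (k + 1)

/-- The canonical form of `k / 2 ^ n`. If `k` is odd and `n > 0` it is
`{(k - 1) / 2 ^ n | (k + 1) / 2 ^ n}`, with both fractions reduced. -/
def ofFraction (k : ℤ) : ℕ → ShortGame
  | 0 => ofInt k
  | n + 1 =>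
    if Even k then ofFraction (k / 2) n
    else switch (ofFraction ((k - 1) / 2) n) (ofFraction ((k + 1) / 2) n)

/-- The canonical form of a dyadic rational. -/
def ofDyadic (x : dyadicRationals) : ShortGame :=
  ofFraction (x : ℚ).num (Nat.log 2 (x : ℚ).den)

open Classical in
mutual

/-- The Left stop: `x` if the game equals the dyadic `x`, and otherwise the largest Right stop of a
Left option. (A game without Left options equals an integer, so the value `0` at the end is never
used.) -/
noncomputable def leftStop : ShortGame → dyadicRationals
  | mk l r L R =>
    if h : ∃ x, Equal (mk l r L R) (ofDyadic x) then h.choose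
    else if h' : (Finset.univ : Finset (Fin l)).Nonempty then
      Finset.univ.sup' h' fun i => rightStop (L i)
    else 0

/-- The Right stop: `x` if the game equals the dyadic `x`, and otherwise the smallest Left stop of a
Right option. -/
noncomputable def rightStop : ShortGame → dyadicRationals
  | mk l r L R =>
    if h : ∃ x, Equal (mk l r L R) (ofDyadic x) then h.choose
    else if h' : (Finset.univ : Finset (Fin r)).Nonempty then
      Finset.univ.inf' h' fun j => leftStop (R j)
    else 0

end

/-- `t` is the smallest penalty `p ≥ 0` for which the Left and Right stops of `H p` agree. -/
def IsFirstMeeting (H : dyadicRationals → ShortGame) (t : dyadicRationals) : Prop :=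
  IsLeast {p | 0 ≤ p ∧ leftStop (H p) = rightStop (H p)} t

open Classical in
/-- The game `G` (in canonical form) penalized by `p ≥ 0`: it is `{G^L_p - p | G^R_p + p}` for
`p ≤ t`, where `t` is the smallest penalty at which the stops of this game are equal, say to `x`,
and it is `x` for `p > t`. -/
noncomputable def penalize : ShortGame → dyadicRationals → ShortGame
  | mk l r L R, p =>
    let H : dyadicRationals → ShortGame := fun q =>
      mk l r (fun i => penalize (L i) q - ofDyadic q) (fun j => penalize (R j) q + ofDyadic q)
    if h : ∃ t, IsFirstMeeting H t ∧ t < p then ofDyadic (leftStop (H h.choose)) else H p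

open Classical in
/-- The temperature: `-1 / 2 ^ n` for a game equal to a dyadic `k / 2 ^ n` in lowest terms, and
otherwise the smallest `p ≥ 0` for which the stops of `G` penalized by `p` are equal. (Such a `p`
exists for every short game, so the value `0` at the end is never used.) -/
noncomputable def temperature (G : ShortGame) : ℚ :=
  if h : ∃ x, Equal G (ofDyadic x) then -1 / ((h.choose : dyadicRationals) : ℚ).den
  else if h' : ∃ t, IsFirstMeeting (penalize G) t then ((h'.choose : dyadicRationals) : ℚ)
  else 0

/-- The small left wall of the thermograph: the points `(ℓ(G_p), p)` with `0 ≤ p ≤ t(G)`. -/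
def smallLeftWall (G : ShortGame) : Set (dyadicRationals × dyadicRationals) :=
  {z | ∃ p : dyadicRationals, 0 ≤ p ∧ (p : ℚ) ≤ G.temperature ∧ z = (leftStop (penalize G p), p)}

/-- The small right wall of the thermograph: the points `(r(G_p), p)` with `0 ≤ p ≤ t(G)`. -/
def smallRightWall (G : ShortGame) : Set (dyadicRationals × dyadicRationals) :=
  {z | ∃ p : dyadicRationals, 0 ≤ p ∧ (p : ℚ) ≤ G.temperature ∧ z = (rightStop (penalize G p), p)}

/-- A wall has slope `k` if its points `(x, p)` satisfy `x = k p + c` for a constant `c`: the stop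
`x` is regarded as a function of the penalty `p`, so that slope `0` is a vertical wall. -/
def HasSlope (A : Set (dyadicRationals × dyadicRationals)) (k : ℤ) : Prop :=
  ∃ c : dyadicRationals, ∀ z ∈ A, z.1 = k * z.2 + c

/-- Hot or tepid games are those of nonnegative temperature. -/
def IsHotOrTepid (G : ShortGame) : Prop := 0 ≤ G.temperature

/-- The thermograph of `G` is a double tent. -/
def IsDoubleTent (G : ShortGame) : Prop :=
  G.IsHotOrTepid ∧ HasSlope G.smallLeftWall (-1) ∧ HasSlope G.smallRightWall 1

/-- The thermograph of `G` is a left single tent. -/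
def IsLeftSingleTent (G : ShortGame) : Prop :=
  G.IsHotOrTepid ∧ HasSlope G.smallLeftWall (-1) ∧ HasSlope G.smallRightWall 0

/-- The thermograph of `G` is a right single tent. -/
def IsRightSingleTent (G : ShortGame) : Prop :=
  G.IsHotOrTepid ∧ HasSlope G.smallLeftWall 0 ∧ HasSlope G.smallRightWall 1

end ShortGame

/-- The Little John position `(n; a, b)*` with heap size `n` and wealths `a` (Left), `b` (Right). -/
def littleJohn (n a b : ℕ) : ShortGame :=
  if _h : n = 0 ∨ (a = 0 ∧ b = 0) then 0
  else if _hb : b = 0 then ShortGame.mk 1 0 ![littleJohn (n - 1) a 0] ![]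
  else if _ha : a = 0 then ShortGame.mk 0 1 ![] ![littleJohn (n - 1) 0 b]
  else
    ShortGame.switch
      (littleJohn (n - min n (min a b)) a (b - min n (min a b)))
      (littleJohn (n - min n (min a b)) (a - min n (min a b)) b)
termination_by n
decreasing_by all_goals omega

-- For 0 < b ≤ a and n ≥ b, Left's move bankrupts Right and leaves the integer n - b, so G = {n - b
-- | H} with H = (n - b; a - b, b)*; the case a ≤ b is the mirror image. Thus (a, b) runs through
-- the subtractive Euclidean algorithm down to a = b, where G = {n - a | -(n - a)} is a double tent.
--
-- The left scaffold wall of G is n - b - p, and the right one is the left wall of H shifted by p.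
-- If H is a double or left single tent, its left wall has slope -1 and the shift makes it vertical,
-- so G is a left single tent. If H is a right single tent, its left wall is vertical, the shift
-- gives slope +1, and G is a double tent. With c = a - b, the first case is c/b ≥ 1/φ, that is a/b
-- = 1 + c/b ≥ 1 + 1/φ = φ; equality is impossible because φ is irrational.
--
-- It remains to know that the walls meet while the wall of H still has the required slope. The
-- invariant `LittleJohnThermograph` therefore bounds single-tent temperatures below by the smaller
-- wealth and above by a constant C, and puts the stops of double tents within C of n and -n, so
-- that their temperatures grow like n.
--
-- The thermographs of `switch` games (`thermograph_switch`) rest on number translation for stops.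
-- This follows from `stops_are_cuts`, which reads the stops off the order between a game and the
-- dyadics and so makes them depend only on the value.

namespace ShortGame

-- Order, sums and negatives of short games

/-- `A` is a Left option of `G`. -/
def IsLeftOption (A G : ShortGame) : Prop := ∃ i, G.left i = A

/-- `A` is a Right option of `G`. -/
def IsRightOption (A G : ShortGame) : Prop := ∃ j, G.right j = A

theorem IsLeftOption.height_lt {A G : ShortGame} (h : IsLeftOption A G) : A.height < G.height := by
  obtain ⟨i, rfl⟩ := h
  exact height_left_lt G i

theorem IsRightOption.height_lt {A G : ShortGame} (h : IsRightOption A G) :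
    A.height < G.height := by
  obtain ⟨i, rfl⟩ := h
  exact height_right_lt G i

theorem le_iff (G H : ShortGame) :
    G ≤ H ↔ (∀ A, IsLeftOption A G → ¬ H ≤ A) ∧ (∀ B, IsRightOption B H → ¬ B ≤ G) := by
  change le G H ↔ (∀ A, IsLeftOption A G → ¬ le H A) ∧ (∀ B, IsRightOption B H → ¬ le B G)
  rw [le]
  simp [IsLeftOption, IsRightOption]

theorem isLeftOption_switch {A G H : ShortGame} : IsLeftOption A (switch G H) ↔ A = G := by
  constructor
  · rintro ⟨i, rfl⟩
    fin_cases i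
    rfl
  · rintro rfl
    exact ⟨(0 : Fin 1), rfl⟩

theorem isRightOption_switch {A G H : ShortGame} : IsRightOption A (switch G H) ↔ A = H := by
  constructor
  · rintro ⟨i, rfl⟩
    fin_cases i
    rfl
  · rintro rfl
    exact ⟨(0 : Fin 1), rfl⟩

theorem not_isLeftOption_zero {A : ShortGame} : ¬ IsLeftOption A 0 := fun ⟨i, _⟩ => i.elim0

theorem not_isRightOption_zero {A : ShortGame} : ¬ IsRightOption A 0 := fun ⟨i, _⟩ => i.elim0

theorem add_eq (G H : ShortGame) : G + H =
    mk (G.numLeft + H.numLeft) (G.numRight + H.numRight)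
      (Fin.append (fun i => G.left i + H) (fun i => G + H.left i))
      (Fin.append (fun j => G.right j + H) (fun j => G + H.right j)) := by
  change add G H = _
  rw [add]
  rfl

theorem isLeftOption_add {A G H : ShortGame} : IsLeftOption A (G + H) ↔
    (∃ G', IsLeftOption G' G ∧ A = G' + H) ∨ (∃ H', IsLeftOption H' H ∧ A = G + H') := by
  rw [add_eq]
  constructor
  · rintro ⟨i, rfl⟩
    change Fin (G.numLeft + H.numLeft) at i
    induction i using Fin.addCases with
    | left i => exact Or.inl ⟨_, ⟨i, rfl⟩, by simp [left]⟩
    | right i => exact Or.inr ⟨_, ⟨i, rfl⟩, by simp [left]⟩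
  · rintro (⟨_, ⟨i, rfl⟩, rfl⟩ | ⟨_, ⟨i, rfl⟩, rfl⟩)
    · exact ⟨Fin.castAdd _ i, by simp [left]⟩
    · exact ⟨Fin.natAdd _ i, by simp [left]⟩

theorem isRightOption_add {A G H : ShortGame} : IsRightOption A (G + H) ↔
    (∃ G', IsRightOption G' G ∧ A = G' + H) ∨ (∃ H', IsRightOption H' H ∧ A = G + H') := by
  rw [add_eq]
  constructor
  · rintro ⟨i, rfl⟩
    change Fin (G.numRight + H.numRight) at i
    induction i using Fin.addCases with
    | left i => exact Or.inl ⟨_, ⟨i, rfl⟩, by simp [right]⟩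
    | right i => exact Or.inr ⟨_, ⟨i, rfl⟩, by simp [right]⟩
  · rintro (⟨_, ⟨i, rfl⟩, rfl⟩ | ⟨_, ⟨i, rfl⟩, rfl⟩)
    · exact ⟨Fin.castAdd _ i, by simp [right]⟩
    · exact ⟨Fin.natAdd _ i, by simp [right]⟩

theorem neg_mk {l r : ℕ} (L : Fin l → ShortGame) (R : Fin r → ShortGame) :
    -(mk l r L R) = mk r l (fun j => -R j) (fun i => -L i) := rfl

protected theorem neg_neg (G : ShortGame) : - -G = G := by
  induction G with
  | mk l r L R ihL ihR => simp only [neg_mk, ihL, ihR]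

theorem isLeftOption_neg {A G : ShortGame} : IsLeftOption A (-G) ↔ IsRightOption (-A) G := by
  cases G with
  | mk l r L R =>
    constructor
    · rintro ⟨i, rfl⟩
      exact ⟨i, (ShortGame.neg_neg _).symm⟩
    · rintro ⟨i, h⟩
      exact ⟨i, (congrArg _ h).trans (ShortGame.neg_neg _)⟩

theorem isRightOption_neg {A G : ShortGame} : IsRightOption A (-G) ↔ IsLeftOption (-A) G := by
  cases G with
  | mk l r L R =>
    constructor
    · rintro ⟨i, rfl⟩
      exact ⟨i, (ShortGame.neg_neg _).symm⟩
    · rintro ⟨i, h⟩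
      exact ⟨i, (congrArg _ h).trans (ShortGame.neg_neg _)⟩

/-- Induction on the options of a game. -/
theorem option_induction {P : ShortGame → Prop}
    (h : ∀ G, (∀ A, IsLeftOption A G → P A) → (∀ B, IsRightOption B G → P B) → P G)
    (G : ShortGame) : P G := by
  induction G with
  | mk l r L R ihL ihR =>
    apply h
    · rintro _ ⟨i, rfl⟩
      exact ihL i
    · rintro _ ⟨i, rfl⟩
      exact ihR i

protected theorem le_refl (G : ShortGame) : G ≤ G := by
  induction G using option_induction with
  | h G ihL ihR =>
    rw [le_iff]
    exact ⟨fun A hA h => ((le_iff _ _).1 h).1 A hA (ihL A hA),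
      fun B hB h => ((le_iff _ _).1 h).2 B hB (ihR B hB)⟩

theorem not_le_left {A G : ShortGame} (h : IsLeftOption A G) : ¬ G ≤ A :=
  ((le_iff _ _).1 (ShortGame.le_refl G)).1 A h

theorem not_right_le {B G : ShortGame} (h : IsRightOption B G) : ¬ B ≤ G :=
  ((le_iff _ _).1 (ShortGame.le_refl G)).2 B h

protected theorem le_trans {G H K : ShortGame} (h : G ≤ H) (h' : H ≤ K) : G ≤ K := by
  rw [le_iff]
  constructor
  · intro A hA hK
    have := hA.height_lt
    exact ((le_iff _ _).1 h).1 A hA (ShortGame.le_trans h' hK)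
  · intro B hB hG
    have := hB.height_lt
    exact ((le_iff _ _).1 h').2 B hB (ShortGame.le_trans hG h)
termination_by G.height + H.height + K.height

/-- The domination criterion: it reduces inequalities to a matching of options, without strategies.
-/
theorem le_of_options {G H : ShortGame}
    (hL : ∀ A, IsLeftOption A G → ∃ A', IsLeftOption A' H ∧ A ≤ A')
    (hR : ∀ B, IsRightOption B H → ∃ B', IsRightOption B' G ∧ B' ≤ B) : G ≤ H := by
  rw [le_iff]
  constructor
  · intro A hA h
    obtain ⟨A', hA', h'⟩ := hL A hA
    exact not_le_left hA' (ShortGame.le_trans h h')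
  · intro B hB h
    obtain ⟨B', hB', h'⟩ := hR B hB
    exact not_right_le hB' (ShortGame.le_trans h' h)

/-- Monotonicity and cancellation are proved together, since each direction calls the other on
options. -/
theorem add_le_add_iff (G H K : ShortGame) : G + K ≤ H + K ↔ G ≤ H := by
  constructor
  · intro h
    rw [le_iff]
    constructor
    · intro A hA hle
      have := hA.height_lt
      exact not_le_left (isLeftOption_add.2 (Or.inl ⟨A, hA, rfl⟩))
        (ShortGame.le_trans h ((add_le_add_iff H A K).2 hle))
    · intro B hB hle
      have := hB.height_lt
      exact not_right_le (isRightOption_add.2 (Or.inl ⟨B, hB, rfl⟩))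
        (ShortGame.le_trans ((add_le_add_iff B G K).2 hle) h)
  · intro h
    rw [le_iff]
    constructor
    · intro A hA hle
      rcases isLeftOption_add.1 hA with ⟨G', hG', rfl⟩ | ⟨K', hK', rfl⟩
      · have := hG'.height_lt
        exact ((le_iff _ _).1 h).1 G' hG' ((add_le_add_iff H G' K).1 hle)
      · have := hK'.height_lt
        exact not_le_left (isLeftOption_add.2 (Or.inr ⟨K', hK', rfl⟩))
          (ShortGame.le_trans hle ((add_le_add_iff G H K').2 h))
    · intro A hA hle
      rcases isRightOption_add.1 hA with ⟨H', hH', rfl⟩ | ⟨K', hK', rfl⟩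
      · have := hH'.height_lt
        exact ((le_iff _ _).1 h).2 H' hH' ((add_le_add_iff H' G K).1 hle)
      · have := hK'.height_lt
        exact not_right_le (isRightOption_add.2 (Or.inr ⟨K', hK', rfl⟩))
          (ShortGame.le_trans ((add_le_add_iff G H K').2 h) hle)
termination_by G.height + H.height + K.height

theorem add_comm_le (G H : ShortGame) : G + H ≤ H + G := by
  apply le_of_options
  · intro A hA
    rcases isLeftOption_add.1 hA with ⟨A, h, rfl⟩ | ⟨A, h, rfl⟩
    · have := h.height_lt
      exact ⟨_, isLeftOption_add.2 (Or.inr ⟨A, h, rfl⟩), add_comm_le A H⟩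
    · have := h.height_lt
      exact ⟨_, isLeftOption_add.2 (Or.inl ⟨A, h, rfl⟩), add_comm_le G A⟩
  · intro A hA
    rcases isRightOption_add.1 hA with ⟨A, h, rfl⟩ | ⟨A, h, rfl⟩
    · have := h.height_lt
      exact ⟨_, isRightOption_add.2 (Or.inr ⟨A, h, rfl⟩), add_comm_le G A⟩
    · have := h.height_lt
      exact ⟨_, isRightOption_add.2 (Or.inl ⟨A, h, rfl⟩), add_comm_le A H⟩
termination_by G.height + H.height

theorem add_le_add {G G' H H' : ShortGame} (h : G ≤ G') (h' : H ≤ H') : G + H ≤ G' + H' :=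
  ShortGame.le_trans ((add_le_add_iff _ _ _).2 h) <|
    ShortGame.le_trans (add_comm_le _ _) <|
      ShortGame.le_trans ((add_le_add_iff _ _ _).2 h') (add_comm_le _ _)

theorem add_assoc_le (G H K : ShortGame) : G + H + K ≤ G + (H + K) := by
  apply le_of_options
  · intro A hA
    simp only [isLeftOption_add] at hA
    rcases hA with ⟨_, ⟨A, h, rfl⟩ | ⟨A, h, rfl⟩, rfl⟩ | ⟨A, h, rfl⟩ <;> have := h.height_lt
    · exact ⟨_, isLeftOption_add.2 (Or.inl ⟨A, h, rfl⟩), add_assoc_le _ _ _⟩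
    · exact ⟨_, isLeftOption_add.2 (Or.inr ⟨_, isLeftOption_add.2 (Or.inl ⟨A, h, rfl⟩), rfl⟩),
        add_assoc_le _ _ _⟩
    · exact ⟨_, isLeftOption_add.2 (Or.inr ⟨_, isLeftOption_add.2 (Or.inr ⟨A, h, rfl⟩), rfl⟩),
        add_assoc_le _ _ _⟩
  · intro A hA
    simp only [isRightOption_add] at hA
    rcases hA with ⟨A, h, rfl⟩ | ⟨_, ⟨A, h, rfl⟩ | ⟨A, h, rfl⟩, rfl⟩ <;> have := h.height_lt
    · exact ⟨_, isRightOption_add.2 (Or.inl ⟨_, isRightOption_add.2 (Or.inl ⟨A, h, rfl⟩), rfl⟩),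
        add_assoc_le _ _ _⟩
    · exact ⟨_, isRightOption_add.2 (Or.inl ⟨_, isRightOption_add.2 (Or.inr ⟨A, h, rfl⟩), rfl⟩),
        add_assoc_le _ _ _⟩
    · exact ⟨_, isRightOption_add.2 (Or.inr ⟨A, h, rfl⟩), add_assoc_le _ _ _⟩
termination_by G.height + H.height + K.height

theorem add_assoc_equal (G H K : ShortGame) : Equal (G + H + K) (G + (H + K)) := by
  refine ⟨add_assoc_le G H K, ?_⟩
  have h₁ := add_comm_le G (H + K)
  have h₂ := add_assoc_le H K G
  have h₃ := add_comm_le H (K + G)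
  have h₄ := add_assoc_le K G H
  have h₅ := add_comm_le K (G + H)
  exact ShortGame.le_trans h₁ (ShortGame.le_trans h₂ 
    (ShortGame.le_trans h₃ (ShortGame.le_trans h₄ h₅)))

theorem add_zero_equal (G : ShortGame) : Equal (G + 0) G := by
  induction G using option_induction with
  | h G ihL ihR =>
    constructor
    · apply le_of_options
      · intro A hA
        rcases isLeftOption_add.1 hA with ⟨A, h, rfl⟩ | ⟨A, h, rfl⟩
        · exact ⟨A, h, (ihL A h).1⟩
        · exact (not_isLeftOption_zero h).elim
      · intro A hA
        exact ⟨_, isRightOption_add.2 (Or.inl ⟨A, hA, rfl⟩), (ihR A hA).1⟩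
    · apply le_of_options
      · intro A hA
        exact ⟨_, isLeftOption_add.2 (Or.inl ⟨A, hA, rfl⟩), (ihL A hA).2⟩
      · intro A hA
        rcases isRightOption_add.1 hA with ⟨A, h, rfl⟩ | ⟨A, h, rfl⟩
        · exact ⟨A, h, (ihR A h).2⟩
        · exact (not_isRightOption_zero h).elim

theorem neg_le_neg_iff (G H : ShortGame) : -H ≤ -G ↔ G ≤ H := by
  rw [le_iff, le_iff, and_comm]
  refine and_congr ⟨fun h A hA hle => ?_, fun h A hA hle => ?_⟩
    ⟨fun h A hA hle => ?_, fun h A hA hle => ?_⟩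
  · have := hA.height_lt
    refine h (-A) ?_ ((neg_le_neg_iff H A).2 hle)
    rwa [isRightOption_neg, ShortGame.neg_neg]
  · rw [isRightOption_neg] at hA
    have := hA.height_lt
    refine h _ hA ((neg_le_neg_iff H (-A)).1 ?_)
    rwa [ShortGame.neg_neg]
  · have := hA.height_lt
    refine h (-A) ?_ ((neg_le_neg_iff A G).2 hle)
    rwa [isLeftOption_neg, ShortGame.neg_neg]
  · rw [isLeftOption_neg] at hA
    have := hA.height_lt
    refine h _ hA ((neg_le_neg_iff (-A) G).1 ?_)
    rwa [ShortGame.neg_neg]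
termination_by G.height + H.height

/-- The copycat strategy: any move in one summand is answered by its mirror image in the other. -/
theorem add_neg_equal (G : ShortGame) : Equal (G + -G) 0 := by
  induction G using option_induction with
  | h G ihL ihR =>
    constructor
    · rw [le_iff]
      refine ⟨fun A hA hle => ?_, fun B hB => (not_isRightOption_zero hB).elim⟩
      rcases isLeftOption_add.1 hA with ⟨A, h, rfl⟩ | ⟨A, h, rfl⟩
      · refine not_right_le (isRightOption_add.2 (Or.inr ⟨-A, ?_, rfl⟩))
          (ShortGame.le_trans (ihL A h).1 hle)
        rwa [isRightOption_neg, ShortGame.neg_neg]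
      · rw [isLeftOption_neg] at h
        refine not_right_le (isRightOption_add.2 (Or.inl ⟨-A, h, rfl⟩))
          (ShortGame.le_trans ?_ hle)
        simpa only [ShortGame.neg_neg] using (ihR _ h).1
    · rw [le_iff]
      refine ⟨fun B hB => (not_isLeftOption_zero hB).elim, fun A hA hle => ?_⟩
      rcases isRightOption_add.1 hA with ⟨A, h, rfl⟩ | ⟨A, h, rfl⟩
      · refine not_le_left (isLeftOption_add.2 (Or.inr ⟨-A, ?_, rfl⟩))
          (ShortGame.le_trans hle (ihR A h).2)
        rwa [isLeftOption_neg, ShortGame.neg_neg]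
      · rw [isRightOption_neg] at h
        refine not_le_left (isLeftOption_add.2 (Or.inl ⟨-A, h, rfl⟩))
          (ShortGame.le_trans hle ?_)
        simpa only [ShortGame.neg_neg] using (ihL _ h).2

-- The ordered group of values

/-- Games up to equality of values. -/
instance valueSetoid : Setoid ShortGame where
  r := Equal
  iseqv := ⟨fun G => ⟨G.le_refl, G.le_refl⟩, fun h => ⟨h.2, h.1⟩,
    fun h h' => ⟨ShortGame.le_trans h.1 h'.1, ShortGame.le_trans h'.2 h.2⟩⟩

/-- The group of values of short games. -/
def Value : Type := Quotient valueSetoid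

/-- The value of a game. -/
def value (G : ShortGame) : Value := Quotient.mk _ G

theorem value_eq_iff {G H : ShortGame} : G.value = H.value ↔ Equal G H := Quotient.eq

namespace Value

instance : PartialOrder Value where
  le := Quotient.lift₂ (fun G H : ShortGame => G ≤ H) fun _ _ _ _ h h' => propext
    ⟨fun h₁ => ShortGame.le_trans h.2 (ShortGame.le_trans h₁ h'.1),
      fun h₁ => ShortGame.le_trans h.1 (ShortGame.le_trans h₁ h'.2)⟩
  le_refl := by
    rintro ⟨G⟩
    exact G.le_refl
  le_trans := by
    rintro ⟨G⟩ ⟨H⟩ ⟨K⟩ h h'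
    exact ShortGame.le_trans h h'
  le_antisymm := by
    rintro ⟨G⟩ ⟨H⟩ h h'
    exact Quotient.sound ⟨h, h'⟩

instance : Add Value where
  add := Quotient.map₂ (· + ·) fun _ _ h _ _ h' => ⟨add_le_add h.1 h'.1, add_le_add h.2 h'.2⟩

instance : Zero Value := ⟨value 0⟩

instance : Neg Value where
  neg := Quotient.map (- ·) fun _ _ h => ⟨(neg_le_neg_iff _ _).2 h.2, (neg_le_neg_iff _ _).2 h.1⟩

instance : AddCommGroup Value where
  add_assoc := by
    rintro ⟨G⟩ ⟨H⟩ ⟨K⟩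
    exact Quotient.sound (add_assoc_equal G H K)
  add_comm := by
    rintro ⟨G⟩ ⟨H⟩
    exact Quotient.sound ⟨add_comm_le _ _, add_comm_le _ _⟩
  add_zero := by
    rintro ⟨G⟩
    exact Quotient.sound (add_zero_equal G)
  zero_add := by
    rintro ⟨G⟩
    exact Quotient.sound ⟨ShortGame.le_trans (add_comm_le _ _) (add_zero_equal G).1,
      ShortGame.le_trans (add_zero_equal G).2 (add_comm_le _ _)⟩
  neg_add_cancel := by
    rintro ⟨G⟩
    exact Quotient.sound ⟨ShortGame.le_trans (add_comm_le _ _) (add_neg_equal G).1,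
      ShortGame.le_trans (add_neg_equal G).2 (add_comm_le _ _)⟩
  nsmul := nsmulRec
  zsmul := zsmulRec

instance : IsOrderedAddMonoid Value where
  add_le_add_left := by
    rintro ⟨G⟩ ⟨H⟩ h ⟨K⟩
    exact (add_le_add_iff G H K).2 h

end Value

theorem value_add (G H : ShortGame) : (G + H).value = G.value + H.value := rfl

theorem value_zero : (0 : ShortGame).value = 0 := rfl

theorem value_neg (G : ShortGame) : (-G).value = -G.value := rfl

theorem value_sub (G H : ShortGame) : (G - H).value = G.value - H.value := by
  rw [sub_eq_add_neg]
  rfl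

theorem IsLeftOption.not_value_le {A G : ShortGame} (h : IsLeftOption A G) :
    ¬ G.value ≤ A.value := not_le_left h

theorem IsRightOption.not_value_le {B G : ShortGame} (h : IsRightOption B G) :
    ¬ B.value ≤ G.value := not_right_le h

theorem value_le_value {G H : ShortGame} (hL : ∀ A, IsLeftOption A G → ¬ H.value ≤ A.value)
    (hR : ∀ B, IsRightOption B H → ¬ B.value ≤ G.value) : G.value ≤ H.value :=
  (le_iff G H).2 ⟨hL, hR⟩

-- Values of integers and dyadic fractions

theorem isLeftOption_ofNat_succ {A : ShortGame} {k : ℕ} :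
    IsLeftOption A (ofNat (k + 1)) ↔ A = ofNat k := by
  constructor
  · rintro ⟨i, rfl⟩
    change Fin 1 at i
    fin_cases i
    rfl
  · rintro rfl
    exact ⟨(0 : Fin 1), rfl⟩

theorem not_isRightOption_ofNat {A : ShortGame} {k : ℕ} : ¬ IsRightOption A (ofNat k) := by
  rintro ⟨i, -⟩
  cases k <;> exact i.elim0

theorem value_ofNat_succ (k : ℕ) :
    (ofNat (k + 1)).value = (ofNat k).value + (ofNat 1).value := by
  induction k with
  | zero => exact (zero_add _).symm
  | succ k ih =>
    rw [← value_add]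
    apply le_antisymm
    · apply value_le_value
      · intro A hA
        rw [isLeftOption_ofNat_succ.1 hA]
        have h := (isLeftOption_add.2 (Or.inr ⟨_, isLeftOption_ofNat_succ.2 rfl, rfl⟩) :
          IsLeftOption (ofNat (k + 1) + ofNat 0) (ofNat (k + 1) + ofNat 1)).not_value_le
        rw [value_add _ (ofNat 0)] at h
        rwa [← add_zero (ofNat (k + 1)).value]
      · intro B hB
        rcases isRightOption_add.1 hB with ⟨B, h, -⟩ | ⟨B, h, -⟩ <;>
          exact (not_isRightOption_ofNat h).elim
    · apply value_le_value
      · intro A hA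
        have key : A.value = (ofNat (k + 1)).value := by
          rcases isLeftOption_add.1 hA with ⟨B, h, rfl⟩ | ⟨B, h, rfl⟩
          · rw [isLeftOption_ofNat_succ.1 h, ih, value_add]
          · rw [isLeftOption_ofNat_succ.1 h, value_add]
            exact add_zero _
        rw [key]
        exact (isLeftOption_ofNat_succ.2 rfl).not_value_le
      · intro B hB
        exact (not_isRightOption_ofNat hB).elim

theorem neg_zero_eq : -(0 : ShortGame) = 0 :=
  (congrArg (mk 0 0 · _) (Subsingleton.elim _ _)).trans
    (congrArg (mk 0 0 _) (Subsingleton.elim _ _))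

theorem value_ofInt_succ (k : ℤ) : (ofInt (k + 1)).value = (ofInt k).value + (ofInt 1).value := by
  cases k with
  | ofNat k => exact value_ofNat_succ k
  | negSucc k =>
    have h : ofInt (Int.negSucc k + 1) = -ofNat k := by
      cases k with
      | zero => exact neg_zero_eq.symm
      | succ k => rfl
    rw [h]
    change _ = (-ofNat (k + 1)).value + (ofNat 1).value
    rw [value_neg, value_neg, value_ofNat_succ]
    abel

theorem ofFraction_two_mul (k : ℤ) (n : ℕ) : ofFraction (2 * k) (n + 1) = ofFraction k n := by
  rw [ofFraction, if_pos (even_two_mul k)]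
  congr 1
  omega

theorem ofFraction_two_mul_add_one (k : ℤ) (n : ℕ) :
    ofFraction (2 * k + 1) (n + 1) = switch (ofFraction k n) (ofFraction (k + 1) n) := by
  rw [ofFraction, if_neg (by simp)]
  congr 2 <;> omega

/-- Keeping the denominator `2 ^ n` unreduced lets options be compared through their integer
numerators alone. -/
theorem exists_of_isLeftOption_ofFraction {A : ShortGame} {k : ℤ} {n : ℕ}
    (h : IsLeftOption A (ofFraction k n)) : ∃ j < k, A = ofFraction j n := by
  induction n generalizing k with
  | zero =>
    cases k with
    | ofNat k =>
      cases k with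
      | zero => exact (not_isLeftOption_zero h).elim
      | succ k => exact ⟨k, by simp, isLeftOption_ofNat_succ.1 h⟩
    | negSucc k =>
      change IsLeftOption A (-ofNat (k + 1)) at h
      exact (not_isRightOption_ofNat (isLeftOption_neg.1 h)).elim
  | succ n ih =>
    obtain ⟨i, rfl | rfl⟩ := Int.even_or_odd' k
    · rw [ofFraction_two_mul] at h
      obtain ⟨j, hj, rfl⟩ := ih h
      exact ⟨2 * j, by omega, (ofFraction_two_mul _ _).symm⟩
    · rw [ofFraction_two_mul_add_one, isLeftOption_switch] at h
      exact ⟨2 * i, by omega, by rw [h, ofFraction_two_mul]⟩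

theorem neg_switch (G H : ShortGame) : -switch G H = switch (-H) (-G) := by
  simp only [switch, neg_mk]
  congr 1 <;> (funext i; fin_cases i; rfl)

theorem neg_ofFraction (k : ℤ) (n : ℕ) : -ofFraction k n = ofFraction (-k) n := by
  induction n generalizing k with
  | zero =>
    cases k with
    | ofNat k =>
      cases k with
      | zero => exact neg_zero_eq
      | succ k => rfl
    | negSucc k => exact ShortGame.neg_neg (ofNat (k + 1))
  | succ n ih =>
    obtain ⟨i, rfl | rfl⟩ := Int.even_or_odd' k
    · rw [ofFraction_two_mul, ih, ← mul_neg, ofFraction_two_mul]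
    · rw [show -(2 * i + 1) = 2 * (-(i + 1)) + 1 by ring, ofFraction_two_mul_add_one,
        ofFraction_two_mul_add_one, neg_switch, ih, ih]
      congr 2
      ring

theorem exists_of_isRightOption_ofFraction {A : ShortGame} {k : ℤ} {n : ℕ}
    (h : IsRightOption A (ofFraction k n)) : ∃ j > k, A = ofFraction j n := by
  rw [← ShortGame.neg_neg A, ← isLeftOption_neg, neg_ofFraction] at h
  obtain ⟨j, hj, hA⟩ := exists_of_isLeftOption_ofFraction h
  exact ⟨-j, by omega, by rw [← neg_ofFraction, ← hA, ShortGame.neg_neg]⟩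

theorem ofFraction_zero (n : ℕ) : ofFraction 0 n = 0 := by
  induction n with
  | zero => rfl
  | succ n ih => exact (ofFraction_two_mul 0 n).trans ih

theorem ofFraction_one_succ (n : ℕ) : ofFraction 1 (n + 1) = switch 0 (ofFraction 1 n) := by
  have := ofFraction_two_mul_add_one 0 n
  simpa [ofFraction_zero] using this

theorem value_ofFraction_one_pos (n : ℕ) : 0 < (ofFraction 1 n).value := by
  have hL : IsLeftOption 0 (ofFraction 1 n) := by
    cases n with
    | zero => exact isLeftOption_ofNat_succ.2 rfl
    | succ n =>
      rw [ofFraction_one_succ]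
      exact isLeftOption_switch.2 rfl
  refine lt_of_le_not_ge (value_le_value (fun A hA => (not_isLeftOption_zero hA).elim)
    fun B hB => ?_) hL.not_value_le
  cases n with
  | zero => exact (not_isRightOption_ofNat hB).elim
  | succ n =>
    rw [ofFraction_one_succ, isRightOption_switch] at hB
    rw [hB]
    exact (value_ofFraction_one_pos n).not_ge

theorem value_ofFraction_eq_zsmul_of_succ {n : ℕ}
    (h : ∀ k, (ofFraction (k + 1) n).value = (ofFraction k n).value + (ofFraction 1 n).value)
    (k : ℤ) : (ofFraction k n).value = k • (ofFraction 1 n).value := by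
  induction k using Int.induction_on with
  | zero => simp [ofFraction_zero, value_zero]
  | succ k ih => rw [h, ih, add_zsmul, one_zsmul]
  | pred k ih =>
    have := h (-k - 1)
    rw [sub_add_cancel, ih] at this
    rw [sub_zsmul, one_zsmul, this]
    abel

/-- Induction on the exponent. Two facts carry the step: twice 1/2^(n+1) is 1/2^n, and an odd
multiple of 1/2^(n+1) is its even predecessor plus 1/2^(n+1). Both come from comparing options. -/
theorem value_ofFraction_add_one (k : ℤ) (n : ℕ) :
    (ofFraction (k + 1) n).value = (ofFraction k n).value + (ofFraction 1 n).value := by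
  induction n generalizing k with
  | zero => exact value_ofInt_succ k
  | succ n ih =>
    have hz := value_ofFraction_eq_zsmul_of_succ ih
    have hX := value_ofFraction_one_pos n
    have hU := value_ofFraction_one_pos (n + 1)
    have hUX : ¬ (ofFraction 1 n).value ≤ (ofFraction 1 (n + 1)).value := by
      apply IsRightOption.not_value_le
      rw [ofFraction_one_succ]
      exact isRightOption_switch.2 rfl
    have hmono : ∀ i j : ℤ, i ≤ j → (ofFraction i n).value ≤ (ofFraction j n).value := by
      intro i j hij
      rw [hz i, hz j]
      exact zsmul_le_zsmul_left hX.le hij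
    have hUX' : (ofFraction 1 (n + 1)).value ≤ (ofFraction 1 n).value := by
      apply value_le_value
      · intro A hA
        rw [ofFraction_one_succ, isLeftOption_switch] at hA
        rw [hA]
        exact hX.not_ge
      · intro B hB hle
        obtain ⟨j, hj, rfl⟩ := exists_of_isRightOption_ofFraction hB
        exact hUX ((hmono _ _ (by omega)).trans hle)
    have h2 : (ofFraction 1 (n + 1)).value + (ofFraction 1 (n + 1)).value =
        (ofFraction 1 n).value := by
      have hLU : ∀ A, IsLeftOption A (ofFraction 1 (n + 1)) → A = 0 := fun A hA => by
        rwa [ofFraction_one_succ, isLeftOption_switch] at hA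
      have hRU : ∀ A, IsRightOption A (ofFraction 1 (n + 1)) → A = ofFraction 1 n :=
        fun A hA => by rwa [ofFraction_one_succ, isRightOption_switch] at hA
      rw [← value_add]
      apply le_antisymm
      · apply value_le_value
        · intro A hA
          have : A.value = (ofFraction 1 (n + 1)).value := by
            rcases isLeftOption_add.1 hA with ⟨B, h, rfl⟩ | ⟨B, h, rfl⟩ <;>
              simp [hLU B h, value_add, value_zero]
          rwa [this]
        · intro B hB hle
          obtain ⟨j, hj, rfl⟩ := exists_of_isRightOption_ofFraction hB
          have h₁ := (hmono (1 + 1) j (by omega)).trans hle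
          rw [ih, value_add] at h₁
          -- With U = 1/2^(n+1) and X = 1/2^n, a Right option of X below U + U gives X + X ≤ U + U,
          -- while U ≤ X; cancelling leaves X ≤ U.
          exact hUX (le_of_add_le_add_right (((add_le_add_right hUX' _)).trans h₁))
      · apply value_le_value
        · intro A hA hle
          obtain ⟨j, hj, rfl⟩ := exists_of_isLeftOption_ofFraction hA
          have h₁ := hle.trans (hmono j 0 (by omega))
          rw [ofFraction_zero, value_zero, value_add] at h₁
          exact (add_pos hU hU).not_ge h₁
        · intro B hB
          have : B.value = (ofFraction 1 n).value + (ofFraction 1 (n + 1)).value := by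
            rcases isRightOption_add.1 hB with ⟨B, h, rfl⟩ | ⟨B, h, rfl⟩ <;>
              simp [hRU B h, value_add, add_comm]
          rw [this]
          exact (lt_add_of_pos_right _ hU).not_ge
    have hodd : ∀ j : ℤ, (ofFraction (2 * j + 1) (n + 1)).value =
        (ofFraction (2 * j) (n + 1)).value + (ofFraction 1 (n + 1)).value := by
      intro j
      rw [ofFraction_two_mul_add_one, ofFraction_two_mul, ← value_add]
      have hYU : ¬ (ofFraction j n + ofFraction 1 (n + 1)).value ≤ (ofFraction j n).value := by
        rw [value_add]
        exact (lt_add_of_pos_right _ hU).not_ge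
      have hSL := (isLeftOption_switch (G := ofFraction j n)
        (H := ofFraction (j + 1) n)).2 rfl |>.not_value_le
      have hSR := (isRightOption_switch (G := ofFraction j n)
        (H := ofFraction (j + 1) n)).2 rfl |>.not_value_le
      apply le_antisymm
      · apply value_le_value
        · intro A hA
          rwa [isLeftOption_switch.1 hA]
        · intro B hB hle
          apply hSR
          refine le_trans ?_ hle
          rcases isRightOption_add.1 hB with ⟨B, h, rfl⟩ | ⟨B, h, rfl⟩
          · obtain ⟨i, hi, rfl⟩ := exists_of_isRightOption_ofFraction h
            exact (hmono _ _ (by omega)).trans (le_add_of_nonneg_right hU.le)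
          · rw [ofFraction_one_succ, isRightOption_switch] at h
            rw [h, ih, value_add]
      · apply value_le_value
        · intro A hA hle
          apply hSL
          refine le_trans hle ?_
          rcases isLeftOption_add.1 hA with ⟨B, h, rfl⟩ | ⟨B, h, rfl⟩
          · obtain ⟨i, hi, rfl⟩ := exists_of_isLeftOption_ofFraction h
            refine le_trans ?_ (hmono (i + 1) j (by omega))
            rw [ih, value_add]
            exact add_le_add_right hUX' _
          · rw [ofFraction_one_succ, isLeftOption_switch] at h
            rw [h, value_add, value_zero, add_zero]
        · intro B hB hle
          rw [isRightOption_switch.1 hB, ih, value_add] at hle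
          exact hUX (le_of_add_le_add_left hle)
    obtain ⟨j, rfl | rfl⟩ := Int.even_or_odd' k
    · exact hodd j
    · rw [hodd, add_assoc (ofFraction _ _).value, h2, show 2 * j + 1 + 1 = 2 * (j + 1) by ring, ofFraction_two_mul,
        ofFraction_two_mul, ih]

theorem value_ofFraction (k : ℤ) (n : ℕ) :
    (ofFraction k n).value = k • (ofFraction 1 n).value :=
  value_ofFraction_eq_zsmul_of_succ (fun k => value_ofFraction_add_one k n) k

end ShortGame

-- The dyadics as an ordered subgroup of the values

theorem dyadicRationals.exists_eq_div (x y : dyadicRationals) :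
    ∃ (k m : ℤ) (n : ℕ), (x : ℚ) = k / 2 ^ n ∧ (y : ℚ) = m / 2 ^ n := by
  obtain ⟨_, k, n, rfl⟩ := x
  obtain ⟨_, m, n', rfl⟩ := y
  refine ⟨k * 2 ^ n', m * 2 ^ n, n + n', ?_, ?_⟩ <;> push_cast <;> rw [pow_add] <;> field_simp

theorem dyadicRationals.exists_add_self_eq (x : dyadicRationals) :
    ∃ y : dyadicRationals, y + y = x := by
  obtain ⟨_, k, n, rfl⟩ := x
  refine ⟨⟨k / 2 ^ (n + 1), k, n + 1, rfl⟩, ?_⟩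
  ext
  push_cast
  rw [pow_succ]
  field_simp
  ring

theorem dyadicRationals.exists_lt_lt {x y : dyadicRationals} (h : x < y) :
    ∃ z : dyadicRationals, x < z ∧ z < y := by
  obtain ⟨z, hz⟩ := dyadicRationals.exists_add_self_eq (x + y)
  exact ⟨z, by linarith, by linarith⟩

namespace ShortGame

/-- Frees `ofDyadic` from lowest terms, so that two dyadics can be handled over a common
denominator. -/
theorem ofDyadic_eq_ofFraction {x : dyadicRationals} {k : ℤ} {n : ℕ} (h : (x : ℚ) = k / 2 ^ n) :
    ofDyadic x = ofFraction k n := by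
  have key : ∀ {k : ℤ} {n : ℕ}, (x : ℚ) = k / 2 ^ n → k.natAbs.Coprime (2 ^ n) →
      ofDyadic x = ofFraction k n := by
    intro k n h hc
    have hp : (0 : ℤ) < 2 ^ n := by positivity
    have hx : (x : ℚ) = (k : ℚ) / ((2 ^ n : ℤ) : ℚ) := by rw [h]; push_cast; rfl
    have hc' : Nat.Coprime k.natAbs (2 ^ n : ℤ).natAbs := by simpa [Int.natAbs_pow] using hc
    have h₁ : (x : ℚ).num = k := by rw [hx, Rat.num_div_eq_of_coprime hp hc']
    have h₂ : (x : ℚ).den = 2 ^ n := by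
      have := Rat.den_div_eq_of_coprime hp hc'
      rw [← hx] at this
      exact_mod_cast this
    rw [ofDyadic, h₁, h₂, Nat.log_pow Nat.one_lt_two]
  induction n generalizing k with
  | zero => exact key h (by simp)
  | succ n ih =>
    obtain ⟨i, rfl | rfl⟩ := Int.even_or_odd' k
    · rw [ofFraction_two_mul]
      apply ih
      rw [h]
      push_cast
      rw [pow_succ]
      field_simp
    · apply key h
      apply Nat.Coprime.pow_right
      rw [Nat.coprime_two_right]
      exact Int.natAbs_odd.2 ⟨i, rfl⟩

theorem ofFraction_eq_ofDyadic (k : ℤ) (n : ℕ) :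
    ofFraction k n = ofDyadic ⟨k / 2 ^ n, k, n, rfl⟩ := (ofDyadic_eq_ofFraction rfl).symm

/-- The value of a dyadic. -/
def dyadicValue (x : dyadicRationals) : Value := (ofDyadic x).value

theorem dyadicValue_add (x y : dyadicRationals) :
    dyadicValue (x + y) = dyadicValue x + dyadicValue y := by
  obtain ⟨k, m, n, hx, hy⟩ := dyadicRationals.exists_eq_div x y
  have hxy : ((x + y : dyadicRationals) : ℚ) = (k + m : ℤ) / 2 ^ n := by
    push_cast
    rw [hx, hy, add_div]
  rw [dyadicValue, dyadicValue, dyadicValue, ofDyadic_eq_ofFraction hx, ofDyadic_eq_ofFraction hy,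
    ofDyadic_eq_ofFraction hxy, value_ofFraction, value_ofFraction k, value_ofFraction m, add_zsmul]

theorem dyadicValue_le_iff {x y : dyadicRationals} : dyadicValue x ≤ dyadicValue y ↔ x ≤ y := by
  obtain ⟨k, m, n, hx, hy⟩ := dyadicRationals.exists_eq_div x y
  rw [dyadicValue, dyadicValue, ofDyadic_eq_ofFraction hx, ofDyadic_eq_ofFraction hy,
    value_ofFraction, value_ofFraction m,
    (zsmul_left_strictMono (value_ofFraction_one_pos n)).le_iff_le, ← Subtype.coe_le_coe, hx, hy,
    div_le_div_iff_of_pos_right (by positivity)]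
  norm_cast

theorem dyadicValue_inj {x y : dyadicRationals} : dyadicValue x = dyadicValue y ↔ x = y := by
  simp only [le_antisymm_iff, dyadicValue_le_iff]

theorem neg_ofDyadic (x : dyadicRationals) : -ofDyadic x = ofDyadic (-x) := by
  obtain ⟨k, m, n, hx, -⟩ := dyadicRationals.exists_eq_div x x
  rw [ofDyadic_eq_ofFraction hx, neg_ofFraction, ofDyadic_eq_ofFraction]
  push_cast
  rw [hx, neg_div]

theorem dyadicValue_neg (x : dyadicRationals) : dyadicValue (-x) = -dyadicValue x := by
  rw [dyadicValue, ← neg_ofDyadic, value_neg]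
  rfl

theorem dyadicValue_zero : dyadicValue 0 = 0 := by
  rw [dyadicValue, ofDyadic_eq_ofFraction (k := 0) (n := 0) (by simp), ofFraction_zero, value_zero]

theorem ofNat_eq_ofDyadic (n : ℕ) : ofNat n = ofDyadic n :=
  (ofDyadic_eq_ofFraction (k := n) (n := 0) (by simp)).symm

theorem value_ofNat (n : ℕ) : (ofNat n).value = dyadicValue n := by
  rw [ofNat_eq_ofDyadic, dyadicValue]

theorem exists_of_isLeftOption_ofDyadic {A : ShortGame} {x : dyadicRationals}
    (h : IsLeftOption A (ofDyadic x)) : ∃ y < x, A = ofDyadic y := by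
  obtain ⟨k, m, n, hx, -⟩ := dyadicRationals.exists_eq_div x x
  rw [ofDyadic_eq_ofFraction hx] at h
  obtain ⟨j, hj, rfl⟩ := exists_of_isLeftOption_ofFraction h
  refine ⟨_, ?_, ofFraction_eq_ofDyadic j n⟩
  rw [← Subtype.coe_lt_coe, hx]
  dsimp only
  gcongr

theorem exists_of_isRightOption_ofDyadic {A : ShortGame} {x : dyadicRationals}
    (h : IsRightOption A (ofDyadic x)) : ∃ y > x, A = ofDyadic y := by
  obtain ⟨k, m, n, hx, -⟩ := dyadicRationals.exists_eq_div x x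
  rw [ofDyadic_eq_ofFraction hx] at h
  obtain ⟨j, hj, rfl⟩ := exists_of_isRightOption_ofFraction h
  refine ⟨_, ?_, ofFraction_eq_ofDyadic j n⟩
  rw [gt_iff_lt, ← Subtype.coe_lt_coe, hx]
  dsimp only
  gcongr

-- Simplicity, stops and number translation

/-- The simplicity theorem: a game that admits a dyadic between its options equals a dyadic. -/
theorem exists_value_eq_dyadicValue {G : ShortGame} (x : dyadicRationals)
    (hL : ∀ A, IsLeftOption A G → ¬ dyadicValue x ≤ A.value)
    (hR : ∀ B, IsRightOption B G → ¬ B.value ≤ dyadicValue x) :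
    ∃ y, G.value = dyadicValue y := by
  by_cases h : G.value = dyadicValue x
  · exact ⟨x, h⟩
  rcases not_and_or.1 (fun h' : G.value ≤ dyadicValue x ∧ dyadicValue x ≤ G.value =>
    h (le_antisymm h'.1 h'.2)) with h | h
  -- If G ≤ x fails, the fault lies with a Right option y of x with y ≤ G. This y is simpler than x
  -- and still fits between the options of G, so the descent continues with y.
  · have : ∃ B, IsRightOption B (ofDyadic x) ∧ B.value ≤ G.value := by
      by_contra! hn
      exact h (value_le_value hL hn)
    obtain ⟨B, hB, hBG⟩ := this
    obtain ⟨y, hy, rfl⟩ := exists_of_isRightOption_ofDyadic hB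
    have := hB.height_lt
    exact exists_value_eq_dyadicValue y
      (fun A hA hle => hL A hA ((dyadicValue_le_iff.2 hy.le).trans hle))
      (fun A hA hle => hA.not_value_le (hle.trans hBG))
  · have : ∃ B, IsLeftOption B (ofDyadic x) ∧ G.value ≤ B.value := by
      by_contra! hn
      exact h (value_le_value hn hR)
    obtain ⟨B, hB, hBG⟩ := this
    obtain ⟨y, hy, rfl⟩ := exists_of_isLeftOption_ofDyadic hB
    have := hB.height_lt
    exact exists_value_eq_dyadicValue y
      (fun A hA hle => hA.not_value_le (hBG.trans hle))
      (fun A hA hle => hR A hA (hle.trans (dyadicValue_le_iff.2 hy.le)))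
termination_by (ofDyadic x).height

theorem value_le_height (G : ShortGame) : G.value ≤ dyadicValue G.height := by
  rw [← value_ofNat]
  refine value_le_value (fun A hA hle => ?_) fun B hB => (not_isRightOption_ofNat hB).elim
  have hlt := hA.height_lt
  have := hle.trans (value_le_height A)
  rw [value_ofNat, dyadicValue_le_iff, Nat.cast_le] at this
  omega
termination_by G.height

theorem neg_height_le_value (G : ShortGame) :
    dyadicValue (-((-G).height : dyadicRationals)) ≤ G.value := by
  rw [dyadicValue_neg, neg_le, ← value_neg]
  exact value_le_height _

/-- Without Left options, any integer below G fits between the options, and simplicity makes G a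
dyadic. Hence the default value 0 of a stop is never reached. -/
theorem exists_isLeftOption {G : ShortGame} (h : ¬ ∃ x, G.value = dyadicValue x) :
    ∃ A, IsLeftOption A G := by
  by_contra! hn
  exact h (exists_value_eq_dyadicValue _ (fun A hA => (hn A hA).elim)
    fun B hB hle => hB.not_value_le (hle.trans (neg_height_le_value G)))

theorem exists_isRightOption {G : ShortGame} (h : ¬ ∃ x, G.value = dyadicValue x) :
    ∃ A, IsRightOption A G := by
  by_contra! hn
  exact h (exists_value_eq_dyadicValue _
    (fun B hB hle => hB.not_value_le ((value_le_height G).trans hle)) fun A hA => (hn A hA).elim)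

theorem equal_ofDyadic_iff {G : ShortGame} {x : dyadicRationals} :
    Equal G (ofDyadic x) ↔ G.value = dyadicValue x := value_eq_iff.symm

theorem stops_of_value_eq {G : ShortGame} {x : dyadicRationals} (h : G.value = dyadicValue x) :
    leftStop G = x ∧ rightStop G = x := by
  have h' : ∃ y, Equal G (ofDyadic y) := ⟨x, equal_ofDyadic_iff.2 h⟩
  have hx : h'.choose = x := by
    rw [← dyadicValue_inj, ← h, ← equal_ofDyadic_iff.1 h'.choose_spec]
  cases G with
  | mk l r L R => rw [leftStop, rightStop, dif_pos h', dif_pos h', hx, and_self]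

theorem leftStop_of_not_dyadic {G : ShortGame} (h : ¬ ∃ x, G.value = dyadicValue x) :
    (∀ A, IsLeftOption A G → rightStop A ≤ leftStop G) ∧
      ∃ A, IsLeftOption A G ∧ rightStop A = leftStop G := by
  obtain ⟨_, ⟨i, -⟩⟩ := exists_isLeftOption h
  simp only [← equal_ofDyadic_iff] at h
  cases G with
  | mk l r L R =>
    have hne : (Finset.univ : Finset (Fin l)).Nonempty := ⟨i, Finset.mem_univ _⟩
    rw [leftStop, dif_neg h, dif_pos hne]
    constructor
    · rintro _ ⟨j, rfl⟩
      exact Finset.le_sup' (fun i => rightStop (L i)) (Finset.mem_univ (j : Fin l))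
    · obtain ⟨j, -, hj⟩ := Finset.exists_mem_eq_sup' hne fun i => rightStop (L i)
      exact ⟨_, ⟨j, rfl⟩, hj.symm⟩

theorem rightStop_of_not_dyadic {G : ShortGame} (h : ¬ ∃ x, G.value = dyadicValue x) :
    (∀ A, IsRightOption A G → rightStop G ≤ leftStop A) ∧
      ∃ A, IsRightOption A G ∧ leftStop A = rightStop G := by
  obtain ⟨_, ⟨i, -⟩⟩ := exists_isRightOption h
  simp only [← equal_ofDyadic_iff] at h
  cases G with
  | mk l r L R =>
    have hne : (Finset.univ : Finset (Fin r)).Nonempty := ⟨i, Finset.mem_univ _⟩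
    rw [rightStop, dif_neg h, dif_pos hne]
    constructor
    · rintro _ ⟨j, rfl⟩
      exact Finset.inf'_le (fun i => leftStop (R i)) (Finset.mem_univ (j : Fin r))
    · obtain ⟨j, -, hj⟩ := Finset.exists_mem_eq_inf' hne fun i => leftStop (R i)
      exact ⟨_, ⟨j, rfl⟩, hj.symm⟩

/-- The Left options are harmless by hypothesis. A Right option y of x with y ≤ G would also satisfy
G ≤ y by induction, making G a dyadic. -/
theorem value_le_of_leftStop_lt_of_options {G : ShortGame}
    (hG : ¬ ∃ x, G.value = dyadicValue x)
    (h : ∀ A, IsLeftOption A G → ∀ x, rightStop A < x → ¬ dyadicValue x ≤ A.value)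
    (x : dyadicRationals) (hx : leftStop G < x) : G.value ≤ dyadicValue x := by
  refine value_le_value
    (fun A hA => h A hA x (((leftStop_of_not_dyadic hG).1 A hA).trans_lt hx)) fun B hB hle => ?_
  obtain ⟨y, hy, rfl⟩ := exists_of_isRightOption_ofDyadic hB
  have := hB.height_lt
  exact hG ⟨y, le_antisymm (value_le_of_leftStop_lt_of_options hG h y (hx.trans hy)) hle⟩
termination_by (ofDyadic x).height

theorem le_value_of_lt_rightStop_of_options {G : ShortGame}
    (hG : ¬ ∃ x, G.value = dyadicValue x)
    (h : ∀ B, IsRightOption B G → ∀ x, x < leftStop B → ¬ B.value ≤ dyadicValue x)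
    (x : dyadicRationals) (hx : x < rightStop G) : dyadicValue x ≤ G.value := by
  refine value_le_value (fun B hB hle => ?_)
    (fun A hA => h A hA x (hx.trans_le ((rightStop_of_not_dyadic hG).1 A hA)))
  obtain ⟨y, hy, rfl⟩ := exists_of_isLeftOption_ofDyadic hB
  have := hB.height_lt
  exact hG ⟨y, le_antisymm hle (le_value_of_lt_rightStop_of_options hG h y (hy.trans hx))⟩
termination_by (ofDyadic x).height

/-- The stops are the cuts that a game makes among the dyadics. -/
theorem stops_are_cuts (G : ShortGame) (x : dyadicRationals) :
    (leftStop G < x → G.value ≤ dyadicValue x) ∧ (x < leftStop G → ¬ G.value ≤ dyadicValue x) ∧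
    (x < rightStop G → dyadicValue x ≤ G.value) ∧
    (rightStop G < x → ¬ dyadicValue x ≤ G.value) := by
  induction G using option_induction generalizing x with
  | h G ihL ihR =>
    by_cases hG : ∃ y, G.value = dyadicValue y
    · obtain ⟨y, hy⟩ := hG
      rw [(stops_of_value_eq hy).1, (stops_of_value_eq hy).2, hy, dyadicValue_le_iff,
        dyadicValue_le_iff, not_le, not_le]
      exact ⟨le_of_lt, id, le_of_lt, id⟩
    · refine ⟨value_le_of_leftStop_lt_of_options hG (fun A hA y => (ihL A hA y).2.2.2) x,
        fun hx hle => ?_,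
        le_value_of_lt_rightStop_of_options hG (fun A hA y => (ihR A hA y).2.1) x,
        fun hx hle => ?_⟩
      -- The Left option attaining the stop already lies above x.
      · obtain ⟨A, hA, h⟩ := (leftStop_of_not_dyadic hG).2
        exact hA.not_value_le (hle.trans ((ihL A hA x).2.2.1 (h ▸ hx)))
      · obtain ⟨A, hA, h⟩ := (rightStop_of_not_dyadic hG).2
        exact hA.not_value_le (((ihR A hA x).1 (h ▸ hx)).trans hle)

/-- Number translation for stops. -/
theorem stops_of_value_eq_add {G H : ShortGame} {x : dyadicRationals}
    (h : H.value = G.value + dyadicValue x) :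
    leftStop H = leftStop G + x ∧ rightStop H = rightStop G + x := by
  have key : ∀ y, (H.value ≤ dyadicValue y ↔ G.value ≤ dyadicValue (y - x)) ∧
      (dyadicValue y ≤ H.value ↔ dyadicValue (y - x) ≤ G.value) := fun y => by
    rw [sub_eq_add_neg, dyadicValue_add, dyadicValue_neg, ← sub_eq_add_neg, h, le_sub_iff_add_le,
      sub_le_iff_le_add]
    exact ⟨Iff.rfl, Iff.rfl⟩
  constructor
  -- A dyadic strictly between two distinct candidate stops would be cut in opposite ways.
  · apply le_antisymm <;> by_contra! hlt <;> obtain ⟨z, h₁, h₂⟩ := dyadicRationals.exists_lt_lt hlt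
    · exact (stops_are_cuts H z).2.1 h₂
        ((key z).1.2 ((stops_are_cuts G _).1 (lt_sub_iff_add_lt.2 h₁)))
    · exact (stops_are_cuts G _).2.1 (sub_lt_iff_lt_add.2 h₂)
        ((key z).1.1 ((stops_are_cuts H _).1 h₁))
  · apply le_antisymm <;> by_contra! hlt <;> obtain ⟨z, h₁, h₂⟩ := dyadicRationals.exists_lt_lt hlt
    · exact (stops_are_cuts G _).2.2.2 (lt_sub_iff_add_lt.2 h₁)
        ((key z).2.1 ((stops_are_cuts H _).2.2.1 h₂))
    · exact (stops_are_cuts H _).2.2.2 h₁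
        ((key z).2.2 ((stops_are_cuts G _).2.2.1 (sub_lt_iff_lt_add.2 h₂)))

theorem leftStop_add_ofDyadic (G : ShortGame) (x : dyadicRationals) :
    leftStop (G + ofDyadic x) = leftStop G + x :=
  (stops_of_value_eq_add (value_add _ _)).1

theorem rightStop_sub_ofDyadic (G : ShortGame) (x : dyadicRationals) :
    rightStop (G - ofDyadic x) = rightStop G - x := by
  rw [sub_eq_add_neg]
  refine (stops_of_value_eq_add ?_).2
  rw [value_sub, dyadicValue_neg, ← sub_eq_add_neg]
  rfl

theorem stops_ofDyadic (x : dyadicRationals) :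
    leftStop (ofDyadic x) = x ∧ rightStop (ofDyadic x) = x := stops_of_value_eq rfl

/-- A switch equal to a dyadic x is no exception: x lies between `rightStop A` and `leftStop B`, so
the hypothesis forces all three to coincide. -/
theorem stops_switch {A B : ShortGame} (h : leftStop B ≤ rightStop A) :
    leftStop (switch A B) = rightStop A ∧ rightStop (switch A B) = leftStop B := by
  by_cases hG : ∃ x, (switch A B).value = dyadicValue x
  · obtain ⟨x, hx⟩ := hG
    have h₁ : rightStop A ≤ x := by
      by_contra! hlt
      refine IsLeftOption.not_value_le (G := switch A B) (isLeftOption_switch.2 rfl) ?_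
      rw [hx]
      exact (stops_are_cuts A x).2.2.1 hlt
    have h₂ : x ≤ leftStop B := by
      by_contra! hlt
      refine IsRightOption.not_value_le (G := switch A B) (isRightOption_switch.2 rfl) ?_
      rw [hx]
      exact (stops_are_cuts B x).1 hlt
    rw [(stops_of_value_eq hx).1, (stops_of_value_eq hx).2]
    exact ⟨le_antisymm (h₂.trans h) h₁, le_antisymm h₂ (h.trans h₁)⟩
  · obtain ⟨A', hA', hA⟩ := (leftStop_of_not_dyadic hG).2
    obtain ⟨B', hB', hB⟩ := (rightStop_of_not_dyadic hG).2
    rw [isLeftOption_switch.1 hA'] at hA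
    rw [isRightOption_switch.1 hB'] at hB
    exact ⟨hA.symm, hB.symm⟩

theorem value_mk_congr {l r : ℕ} {L L' : Fin l → ShortGame} {R R' : Fin r → ShortGame}
    (hL : ∀ i, (L i).value = (L' i).value) (hR : ∀ j, (R j).value = (R' j).value) :
    (mk l r L R).value = (mk l r L' R').value := by
  apply le_antisymm
  · apply le_of_options
    · rintro _ ⟨i, rfl⟩
      exact ⟨_, ⟨i, rfl⟩, (hL i).le⟩
    · rintro _ ⟨i, rfl⟩
      exact ⟨_, ⟨i, rfl⟩, (hR i).le⟩
  · apply le_of_options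
    · rintro _ ⟨i, rfl⟩
      exact ⟨_, ⟨i, rfl⟩, (hL i).ge⟩
    · rintro _ ⟨i, rfl⟩
      exact ⟨_, ⟨i, rfl⟩, (hR i).ge⟩

-- Penalized games and the thermograph of a switch

/-- The options of `G` penalized by `p`, before the thermograph is capped by its mast. -/
noncomputable def scaffold (G : ShortGame) (p : dyadicRationals) : ShortGame :=
  mk G.numLeft G.numRight (fun i => penalize (G.left i) p - ofDyadic p)
    (fun j => penalize (G.right j) p + ofDyadic p)

open Classical in
theorem penalize_eq (G : ShortGame) (p : dyadicRationals) :
    penalize G p = if h : ∃ t, IsFirstMeeting (scaffold G) t ∧ t < p then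
      ofDyadic (leftStop (scaffold G h.choose)) else scaffold G p := by
  cases G with
  | mk l r L R =>
    rw [penalize]
    rfl

theorem penalize_of_le {G : ShortGame} {p : dyadicRationals}
    (h : ∀ t, IsFirstMeeting (scaffold G) t → p ≤ t) : penalize G p = scaffold G p := by
  rw [penalize_eq, dif_neg]
  rintro ⟨t, ht, hlt⟩
  exact (h t ht).not_gt hlt

theorem penalize_of_lt {G : ShortGame} {p t : dyadicRationals}
    (ht : IsFirstMeeting (scaffold G) t) (h : t < p) :
    penalize G p = ofDyadic (leftStop (scaffold G t)) := by
  have h' : ∃ t, IsFirstMeeting (scaffold G) t ∧ t < p := ⟨t, ht, h⟩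
  rw [penalize_eq, dif_pos h', IsLeast.unique h'.choose_spec.1 ht]

theorem value_penalize_zero (G : ShortGame) : (penalize G 0).value = G.value := by
  rw [penalize_of_le fun t ht => ht.1.1]
  induction G with
  | mk l r L R ihL ihR =>
    apply value_mk_congr
    · intro i
      rw [value_sub]
      change _ - dyadicValue 0 = _
      rw [dyadicValue_zero, sub_zero, penalize_of_le fun t ht => ht.1.1]
      exact ihL i
    · intro i
      rw [value_add]
      change _ + dyadicValue 0 = _
      rw [dyadicValue_zero, add_zero, penalize_of_le fun t ht => ht.1.1]
      exact ihR i

/-- The scaffold at penalty 0 has the value of G, so its stops meet there already and the whole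
thermograph is a mast at x. -/
theorem stops_penalize_of_value_eq {G : ShortGame} {x p : dyadicRationals}
    (h : G.value = dyadicValue x) (hp : 0 ≤ p) :
    leftStop (penalize G p) = x ∧ rightStop (penalize G p) = x := by
  have h₀ : (scaffold G 0).value = dyadicValue x := by
    rw [← penalize_of_le fun t ht => ht.1.1, value_penalize_zero, h]
  have hs := stops_of_value_eq h₀
  have hm : IsFirstMeeting (scaffold G) 0 :=
    ⟨⟨le_rfl, hs.1.trans hs.2.symm⟩, fun t ht => ht.1⟩
  rcases hp.eq_or_lt with rfl | hp
  · rw [penalize_of_le fun t ht => ht.1.1]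
    exact hs
  · rw [penalize_of_lt hm hp, hs.1]
    exact stops_ofDyadic x

theorem scaffold_switch (A B : ShortGame) (p : dyadicRationals) :
    scaffold (switch A B) p = switch (penalize A p - ofDyadic p) (penalize B p + ofDyadic p) := by
  simp only [scaffold, switch]
  congr 1
  · funext i
    fin_cases i
    rfl
  · funext i
    fin_cases i
    rfl

theorem stops_scaffold_switch {A B : ShortGame} {p : dyadicRationals}
    (h : leftStop (penalize B p) + p ≤ rightStop (penalize A p) - p) :
    leftStop (scaffold (switch A B) p) = rightStop (penalize A p) - p ∧
      rightStop (scaffold (switch A B) p) = leftStop (penalize B p) + p := by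
  rw [scaffold_switch, ← leftStop_add_ofDyadic, ← rightStop_sub_ofDyadic]
  apply stops_switch
  rwa [leftStop_add_ofDyadic, rightStop_sub_ofDyadic]

/-- The thermograph of `{A | B}`, if the walls of its scaffold first meet at `t > 0`. -/
theorem thermograph_switch {A B : ShortGame} {t : dyadicRationals} (ht : 0 < t)
    (h₁ : leftStop (penalize B t) + t = rightStop (penalize A t) - t)
    (h₂ : ∀ p, 0 ≤ p → p < t →
      leftStop (penalize B p) + p < rightStop (penalize A p) - p) :
    (switch A B).temperature = t ∧
    (∀ p, 0 ≤ p → p ≤ t → leftStop (penalize (switch A B) p) = rightStop (penalize A p) - p ∧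
      rightStop (penalize (switch A B) p) = leftStop (penalize B p) + p) ∧
    ∀ p, t ≤ p → leftStop (penalize (switch A B) p) = leftStop (penalize B t) + t ∧
      rightStop (penalize (switch A B) p) = leftStop (penalize B t) + t := by
  have hle : ∀ p, 0 ≤ p → p ≤ t →
      leftStop (penalize B p) + p ≤ rightStop (penalize A p) - p := fun p hp hpt =>
    hpt.eq_or_lt.elim (fun h => h ▸ h₁.le) fun h => (h₂ p hp h).le
  have hs : ∀ p, 0 ≤ p → p ≤ t → _ := fun p hp hpt => stops_scaffold_switch (hle p hp hpt)
  have hm : IsFirstMeeting (scaffold (switch A B)) t := by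
    refine ⟨⟨ht.le, ?_⟩, fun p hp => ?_⟩
    · rw [(hs t ht.le le_rfl).1, (hs t ht.le le_rfl).2, h₁]
    · by_contra! hlt
      have := hp.2
      rw [(hs p hp.1 hlt.le).1, (hs p hp.1 hlt.le).2] at this
      exact (h₂ p hp.1 hlt).ne' this
  have hpen : ∀ p, p ≤ t → penalize (switch A B) p = scaffold (switch A B) p := fun p hp =>
    penalize_of_le fun t' ht' => (IsLeast.unique ht' hm).symm ▸ hp
  have hin : ∀ p, 0 ≤ p → p ≤ t →
      leftStop (penalize (switch A B) p) = rightStop (penalize A p) - p ∧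
      rightStop (penalize (switch A B) p) = leftStop (penalize B p) + p := fun p hp hpt => by
    rw [hpen p hpt]
    exact hs p hp hpt
  -- The meeting of the scaffold, `hm`, governs the cap; the temperature is defined by the meeting
  -- of the penalized game itself.
  have hmp : IsFirstMeeting (penalize (switch A B)) t := by
    refine ⟨⟨ht.le, ?_⟩, fun p hp => ?_⟩
    · rw [(hin t ht.le le_rfl).1, (hin t ht.le le_rfl).2, h₁]
    · by_contra! hlt
      have := hp.2
      rw [(hin p hp.1 hlt.le).1, (hin p hp.1 hlt.le).2] at this
      exact (h₂ p hp.1 hlt).ne' this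
  refine ⟨?_, hin, fun p hp => ?_⟩
  · have hn : ¬ ∃ x, Equal (switch A B) (ofDyadic x) := by
      rintro ⟨x, hx⟩
      have h := stops_penalize_of_value_eq (equal_ofDyadic_iff.1 hx) (le_refl 0)
      rw [(hin 0 le_rfl ht.le).1, (hin 0 le_rfl ht.le).2] at h
      exact (h₂ 0 le_rfl ht).ne (h.2.trans h.1.symm)
    have hex : ∃ t, IsFirstMeeting (penalize (switch A B)) t := ⟨t, hmp⟩
    rw [temperature, dif_neg hn, dif_pos hex, IsLeast.unique hex.choose_spec hmp]
  · rcases hp.eq_or_lt with rfl | hlt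
    · rw [(hin t ht.le le_rfl).1, (hin t ht.le le_rfl).2, h₁]
      exact ⟨rfl, rfl⟩
    · rw [penalize_of_lt hm hlt, (hs t ht.le le_rfl).1, h₁]
      exact stops_ofDyadic _

-- Tents and how a switch produces them

/-- The thermograph of `G` has temperature `t` and mast value `m`, with a left wall of slope `-1`
and a vertical right wall. -/
structure LeftTentAt (G : ShortGame) (m t : dyadicRationals) : Prop where
  pos : 0 < t
  temperature_eq : G.temperature = t
  leftStop_eq : ∀ p, 0 ≤ p → p ≤ t → leftStop (penalize G p) = m + t - p
  rightStop_eq : ∀ p, 0 ≤ p → rightStop (penalize G p) = m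

/-- The thermograph of `G` has temperature `t` and mast value `m`, with a vertical left wall and
a right wall of slope `1`. -/
structure RightTentAt (G : ShortGame) (m t : dyadicRationals) : Prop where
  pos : 0 < t
  temperature_eq : G.temperature = t
  leftStop_eq : ∀ p, 0 ≤ p → leftStop (penalize G p) = m
  rightStop_eq : ∀ p, 0 ≤ p → p ≤ t → rightStop (penalize G p) = m - t + p

/-- The thermograph of `G` has temperature `t`, a left wall of slope `-1` that starts at `l` and a
right wall of slope `1` that starts at `r`. -/
structure DoubleTentAt (G : ShortGame) (l r t : dyadicRationals) : Prop where
  pos : 0 < t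
  add_self : t + t = l - r
  temperature_eq : G.temperature = t
  leftStop_eq : ∀ p, 0 ≤ p → p ≤ t → leftStop (penalize G p) = l - p
  rightStop_eq : ∀ p, 0 ≤ p → p ≤ t → rightStop (penalize G p) = r + p

theorem LeftTentAt.isLeftSingleTent {G : ShortGame} {m t : dyadicRationals}
    (h : LeftTentAt G m t) : G.IsLeftSingleTent := by
  refine ⟨?_, ⟨m + t, ?_⟩, ⟨m, ?_⟩⟩
  · rw [IsHotOrTepid, h.temperature_eq]
    exact_mod_cast h.pos.le
  · rintro _ ⟨p, hp, hpt, rfl⟩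
    rw [h.temperature_eq] at hpt
    rw [h.leftStop_eq p hp (by exact_mod_cast hpt)]
    push_cast
    ring
  · rintro _ ⟨p, hp, -, rfl⟩
    rw [h.rightStop_eq p hp]
    simp

theorem RightTentAt.isRightSingleTent {G : ShortGame} {m t : dyadicRationals}
    (h : RightTentAt G m t) : G.IsRightSingleTent := by
  refine ⟨?_, ⟨m, ?_⟩, ⟨m - t, ?_⟩⟩
  · rw [IsHotOrTepid, h.temperature_eq]
    exact_mod_cast h.pos.le
  · rintro _ ⟨p, hp, -, rfl⟩
    rw [h.leftStop_eq p hp]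
    simp
  · rintro _ ⟨p, hp, hpt, rfl⟩
    rw [h.temperature_eq] at hpt
    rw [h.rightStop_eq p hp (by exact_mod_cast hpt)]
    push_cast
    ring

theorem DoubleTentAt.isDoubleTent {G : ShortGame} {l r t : dyadicRationals}
    (h : DoubleTentAt G l r t) : G.IsDoubleTent := by
  refine ⟨?_, ⟨l, ?_⟩, ⟨r, ?_⟩⟩
  · rw [IsHotOrTepid, h.temperature_eq]
    exact_mod_cast h.pos.le
  all_goals
    rintro _ ⟨p, hp, hpt, rfl⟩
    rw [h.temperature_eq] at hpt
  · rw [h.leftStop_eq p hp (by exact_mod_cast hpt)]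
    push_cast
    ring
  · rw [h.rightStop_eq p hp (by exact_mod_cast hpt)]
    push_cast
    ring

/-- Adding the penalty to the wall `y - p` of B makes it vertical, and `x - p` runs into it at
height `x - y`. The wall of B must keep its slope up to that height, whence `hs`. -/
theorem leftTentAt_switch {A B : ShortGame} {x y s : dyadicRationals}
    (hA : ∀ p, 0 ≤ p → rightStop (penalize A p) = x)
    (hB : ∀ p, 0 ≤ p → p ≤ s → leftStop (penalize B p) = y - p)
    (hlt : y < x) (hs : x - y ≤ s) : LeftTentAt (switch A B) y (x - y) := by
  have ht : 0 < x - y := sub_pos.2 hlt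
  obtain ⟨h₁, h₂, h₃⟩ := thermograph_switch (A := A) (B := B) ht
    (by rw [hA _ ht.le, hB _ ht.le hs]; ring)
    (fun p hp hpt => by rw [hA _ hp, hB _ hp (hpt.le.trans hs)]; linarith)
  refine ⟨ht, h₁, fun p hp hpt => ?_, fun p hp => ?_⟩
  · rw [(h₂ p hp hpt).1, hA p hp]
    ring
  · rcases le_total p (x - y) with hpt | hpt
    · rw [(h₂ p hp hpt).2, hB p hp (hpt.trans hs)]
      ring
    · rw [(h₃ p hpt).2, hB _ ht.le hs]
      ring

theorem rightTentAt_switch {A B : ShortGame} {x y s : dyadicRationals}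
    (hA : ∀ p, 0 ≤ p → p ≤ s → rightStop (penalize A p) = x + p)
    (hB : ∀ p, 0 ≤ p → leftStop (penalize B p) = y)
    (hlt : y < x) (hs : x - y ≤ s) : RightTentAt (switch A B) x (x - y) := by
  have ht : 0 < x - y := sub_pos.2 hlt
  obtain ⟨h₁, h₂, h₃⟩ := thermograph_switch (A := A) (B := B) ht
    (by rw [hB _ ht.le, hA _ ht.le hs]; ring)
    (fun p hp hpt => by rw [hB _ hp, hA _ hp (hpt.le.trans hs)]; linarith)
  refine ⟨ht, h₁, fun p hp => ?_, fun p hp hpt => ?_⟩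
  · rcases le_total p (x - y) with hpt | hpt
    · rw [(h₂ p hp hpt).1, hA p hp (hpt.trans hs)]
      ring
    · rw [(h₃ p hpt).1, hB _ ht.le]
      ring
  · rw [(h₂ p hp hpt).2, hB p hp]
    ring

/-- Two vertical walls approach each other at unit speed and meet at half their distance. They are
needed at all heights, since in Little John this meeting lies on the masts of the options. -/
theorem exists_doubleTentAt_switch {A B : ShortGame} {x y : dyadicRationals}
    (hA : ∀ p, 0 ≤ p → rightStop (penalize A p) = x)
    (hB : ∀ p, 0 ≤ p → leftStop (penalize B p) = y) (hlt : y < x) :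
    ∃ t, DoubleTentAt (switch A B) x y t := by
  obtain ⟨t, ht⟩ := dyadicRationals.exists_add_self_eq (x - y)
  have ht₀ : 0 < t := by linarith
  obtain ⟨h₁, h₂, -⟩ := thermograph_switch (A := A) (B := B) ht₀
    (by rw [hA _ ht₀.le, hB _ ht₀.le]; linear_combination ht)
    (fun p hp hpt => by rw [hA _ hp, hB _ hp]; linarith)
  refine ⟨t, ht₀, ht, h₁, fun p hp hpt => ?_, fun p hp hpt => ?_⟩
  · rw [(h₂ p hp hpt).1, hA p hp]
  · rw [(h₂ p hp hpt).2, hB p hp]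

end ShortGame

open ShortGame

-- Little John positions as switches

theorem littleJohn_right_zero {a : ℕ} (ha : 0 < a) (n : ℕ) : littleJohn n a 0 = ofNat n := by
  induction n with
  | zero => rw [littleJohn, dif_pos (Or.inl rfl)]; rfl
  | succ n ih =>
    rw [littleJohn, dif_neg (by omega), dif_pos rfl, Nat.add_sub_cancel, ih]
    rfl

theorem littleJohn_left_zero {b : ℕ} (hb : 0 < b) (n : ℕ) : littleJohn n 0 b = -ofNat n := by
  induction n with
  | zero => rw [littleJohn, dif_pos (Or.inl rfl)]; exact neg_zero_eq.symm
  | succ n ih =>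
    rw [littleJohn, dif_neg (by omega), dif_neg (by omega), dif_pos rfl, Nat.add_sub_cancel, ih]
    change _ = mk 0 1 _ _
    congr 1
    · exact Subsingleton.elim _ _
    · funext i
      fin_cases i
      rfl

theorem littleJohn_of_le {n a b : ℕ} (hb : 0 < b) (hab : b ≤ a) (hn : b ≤ n) :
    littleJohn n a b = switch (ofNat (n - b)) (littleJohn (n - b) (a - b) b) := by
  rw [littleJohn, dif_neg (by omega), dif_neg (by omega), dif_neg (by omega), min_eq_right hab,
    min_eq_right hn, Nat.sub_self, littleJohn_right_zero (by omega)]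

theorem littleJohn_of_ge {n a b : ℕ} (ha : 0 < a) (hab : a ≤ b) (hn : a ≤ n) :
    littleJohn n a b = switch (littleJohn (n - a) a (b - a)) (-ofNat (n - a)) := by
  rw [littleJohn, dif_neg (by omega), dif_neg (by omega), dif_neg (by omega), min_eq_left hab,
    min_eq_right hn, Nat.sub_self, littleJohn_left_zero (by omega)]

theorem rightStop_penalize_ofNat (n : ℕ) (p : dyadicRationals) (hp : 0 ≤ p) :
    rightStop (penalize (ofNat n) p) = n := (stops_penalize_of_value_eq (value_ofNat n) hp).2

theorem leftStop_penalize_neg_ofNat (n : ℕ) (p : dyadicRationals) (hp : 0 ≤ p) :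
    leftStop (penalize (-ofNat n) p) = -n :=
  (stops_penalize_of_value_eq (by rw [value_neg, value_ofNat, dyadicValue_neg]) hp).1

-- The golden ratio as a quadratic inequality

theorem goldenRatio_lt_div_iff {a b : ℕ} (hb : 0 < b) :
    Real.goldenRatio < (a : ℝ) / b ↔ a * b + b * b < a * a := by
  have hb' : (0 : ℝ) < b := by exact_mod_cast hb
  have h₁ := Real.one_lt_goldenRatio
  have h₂ := Real.goldenRatio_sq
  have ha : (0 : ℝ) ≤ a := a.cast_nonneg
  -- The form a² - ab - b² factors over φ and its conjugate 1 - φ; the second factor is positive, so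
  -- the sign is that of a - φb.
  have key : (a : ℝ) * a - (a * b + b * b) =
      (a - Real.goldenRatio * b) * (a + (Real.goldenRatio - 1) * b) := by
    linear_combination (b : ℝ) ^ 2 * h₂
  have hpos : 0 < (a : ℝ) + (Real.goldenRatio - 1) * b := by
    have := mul_pos (sub_pos.2 h₁) hb'
    linarith
  rw [lt_div_iff₀ hb', ← sub_pos, ← mul_pos_iff_of_pos_right hpos, ← key, sub_pos]
  exact_mod_cast Iff.rfl

theorem div_lt_inv_goldenRatio_iff {a b : ℕ} (ha : 0 < a) (hb : 0 < b) :
    (a : ℝ) / b < Real.goldenRatio⁻¹ ↔ a * b + a * a < b * b := by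
  rw [mul_comm a b, ← goldenRatio_lt_div_iff ha, lt_inv_comm₀ (by positivity)
    Real.goldenRatio_pos, inv_div]

/-- Equality would make φ the rational number a/b. This removes the boundary case from the
trichotomy. -/
theorem mul_add_mul_self_ne {a b : ℕ} (hb : 0 < b) : a * b + b * b ≠ a * a := by
  intro h
  have hb' : (b : ℝ) ≠ 0 := by exact_mod_cast hb.ne'
  have h' : (a : ℝ) * b + b * b = a * a := by exact_mod_cast h
  have h₂ := Real.goldenRatio_sq
  have key : ((a : ℝ) - Real.goldenRatio * b) * (a + (Real.goldenRatio - 1) * b) = 0 := by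
    linear_combination -(b : ℝ) ^ 2 * h₂ - h'
  have hpos : (a : ℝ) + (Real.goldenRatio - 1) * b ≠ 0 := by
    have h₁ : 0 < (b : ℝ) := by exact_mod_cast hb
    have := mul_pos (sub_pos.2 Real.one_lt_goldenRatio) h₁
    positivity
  have h₃ : (a : ℝ) = Real.goldenRatio * b := by
    simpa [hpos, sub_eq_zero] using key
  refine Real.goldenRatio_irrational ⟨(a : ℚ) / b, ?_⟩
  push_cast
  rw [h₃, mul_div_cancel_right₀ _ hb']

-- The induction along the subtractive Euclidean algorithm

/-- The thermographs of the positions `(n; a, b)*` with `n ≥ C`, with bounds on their stops and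
temperatures. -/
def LittleJohnThermograph (a b C n : ℕ) : Prop :=
  (a * b + b * b < a * a → ∃ t : dyadicRationals, b ≤ t ∧ t ≤ C ∧
    LeftTentAt (littleJohn n a b) (n - b - t) t) ∧
  (a * b + a * a < b * b → ∃ t : dyadicRationals, a ≤ t ∧ t ≤ C ∧
    RightTentAt (littleJohn n a b) (-(n - a - t)) t) ∧
  (¬ a * b + b * b < a * a → ¬ a * b + a * a < b * b → ∃ l r t : dyadicRationals,
    n - C ≤ l ∧ l ≤ n - b ∧ n - C ≤ -r ∧ -r ≤ n - a ∧ DoubleTentAt (littleJohn n a b) l r t)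

/-- Each player's move bankrupts the other, leaving {n - a | -(n - a)}; the extra 1 in the bound
makes this hot. -/
theorem littleJohnThermograph_self {a n : ℕ} (ha : 0 < a) (hn : a + 1 ≤ n) :
    LittleJohnThermograph a a (a + 1) n := by
  refine ⟨fun h => by omega, fun h => by omega, fun _ _ => ?_⟩
  have hn' : (a : dyadicRationals) + 1 ≤ n := by exact_mod_cast hn
  rw [littleJohn_of_le ha le_rfl (by omega), Nat.sub_self, littleJohn_left_zero ha]
  obtain ⟨t, ht⟩ := exists_doubleTentAt_switch (rightStop_penalize_ofNat (n - a))
    (leftStop_penalize_neg_ofNat (n - a)) (by push_cast [show a ≤ n by omega]; linarith)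
  push_cast [show a ≤ n by omega] at ht ⊢
  exact ⟨_, _, t, by linarith, le_rfl, by linarith, by linarith, ht⟩

/-- With a = b + c, the inequality ab + b² < a² reads b² < bc + c²: the test φ < a/b for the
position is the test 1/φ < c/b for its Right option. The new constant is generous; it exceeds 2C +
b, which the double-tent case below needs. -/
theorem littleJohnThermograph_add_left {b c C n : ℕ} (hb : 0 < b) (hc : 0 < c)
    (h : ∀ n, C ≤ n → LittleJohnThermograph c b C n) (hn : C + C + (b + c) + b + 1 ≤ n) :
    LittleJohnThermograph (b + c) b (C + C + (b + c) + b + 1) n := by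
  obtain ⟨h₁, h₂, h₃⟩ := h (n - b) (by omega)
  have hn' : (C : dyadicRationals) + C + (b + c) + b + 1 ≤ n := by exact_mod_cast hn
  have hb' : (0 : dyadicRationals) < b := by exact_mod_cast hb
  have hc' : (0 : dyadicRationals) < c := by exact_mod_cast hc
  have hC' : (0 : dyadicRationals) ≤ C := C.cast_nonneg
  have hA := rightStop_penalize_ofNat (n - b)
  rw [LittleJohnThermograph, littleJohn_of_le hb (by omega) (by omega), Nat.add_sub_cancel_left]
  push_cast [show b ≤ n by omega] at h₁ h₂ h₃ hA ⊢
  refine ⟨fun hlt => ?_, fun hlt => by nlinarith, fun hlt _ => ?_⟩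
  · by_cases hcb : c * b + b * b < c * c
    · obtain ⟨t, ht₁, ht₂, ht⟩ := h₁ hcb
      -- The left wall of the option starts at n - 2b, so the walls meet at height b; the invariant
      -- `b ≤ t` keeps this below the option's temperature.
      have := leftTentAt_switch (y := n - b - b) hA
        (fun p hp hpt => (ht.leftStop_eq p hp hpt).trans (by ring)) (by linarith) (by linarith)
      refine ⟨b, le_rfl, by linarith, ?_⟩
      convert this using 1
      ring
    · obtain ⟨l, r, t, hl₁, hl₂, hr₁, hr₂, ht⟩ := h₃ hcb (by nlinarith)
      have hts := ht.add_self
      -- The walls meet at height n - b - l ≤ C, whereas the option's temperature (l - r)/2 is at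
      -- least n - b - C ≥ C.
      have := leftTentAt_switch hA ht.leftStop_eq (by linarith) (by linarith)
      refine ⟨n - b - l, by linarith, by linarith, ?_⟩
      convert this using 1
      ring
  · have hne := mul_add_mul_self_ne (a := b) hc
    -- Failure of the strict inequality gives only bc + c² ≤ b²; irrationality makes it strict, so
    -- the option is a right single tent.
    obtain ⟨t, ht₁, ht₂, ht⟩ := h₂ (lt_of_le_of_ne (by nlinarith) fun h => hne (by linarith))
    obtain ⟨s, hs⟩ := exists_doubleTentAt_switch hA ht.leftStop_eq (by linarith)
    exact ⟨_, _, s, by linarith, by linarith, by linarith, by linarith, hs⟩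

theorem littleJohnThermograph_add_right {a c C n : ℕ} (ha : 0 < a) (hc : 0 < c)
    (h : ∀ n, C ≤ n → LittleJohnThermograph a c C n) (hn : C + C + (a + c) + a + 1 ≤ n) :
    LittleJohnThermograph a (a + c) (C + C + (a + c) + a + 1) n := by
  obtain ⟨h₁, h₂, h₃⟩ := h (n - a) (by omega)
  have hn' : (C : dyadicRationals) + C + (a + c) + a + 1 ≤ n := by exact_mod_cast hn
  have ha' : (0 : dyadicRationals) < a := by exact_mod_cast ha
  have hc' : (0 : dyadicRationals) < c := by exact_mod_cast hc
  have hC' : (0 : dyadicRationals) ≤ C := C.cast_nonneg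
  have hB := leftStop_penalize_neg_ofNat (n - a)
  rw [LittleJohnThermograph, littleJohn_of_ge ha (by omega) (by omega), Nat.add_sub_cancel_left]
  push_cast [show a ≤ n by omega] at h₁ h₂ h₃ hB ⊢
  refine ⟨fun hlt => by nlinarith, fun hlt => ?_, fun _ hlt => ?_⟩
  · by_cases hca : a * c + a * a < c * c
    · obtain ⟨t, ht₁, ht₂, ht⟩ := h₂ hca
      have := rightTentAt_switch (x := -(n - a - a))
        (fun p hp hpt => (ht.rightStop_eq p hp hpt).trans (by ring)) hB (by linarith) (by linarith)
      refine ⟨a, le_rfl, by linarith, ?_⟩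
      convert this using 1
      ring
    -- Here the option's right wall `r + p` loses its slope, and Right's integer wall meets it at
    -- height r + n - a ≤ C.
    · obtain ⟨l, r, t, hl₁, hl₂, hr₁, hr₂, ht⟩ := h₃ (by nlinarith) hca
      have hts := ht.add_self
      have := rightTentAt_switch ht.rightStop_eq hB (by linarith) (by linarith)
      refine ⟨r + (n - a), by linarith, by linarith, ?_⟩
      convert this using 1 <;> ring
  · have hne := mul_add_mul_self_ne (a := a) hc
    obtain ⟨t, ht₁, ht₂, ht⟩ := h₁ (lt_of_le_of_ne (by nlinarith) fun h => hne (by linarith))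
    obtain ⟨s, hs⟩ := exists_doubleTentAt_switch ht.rightStop_eq hB (by linarith)
    exact ⟨_, _, s, by linarith, by linarith, by linarith, by linarith, hs⟩

/-- Subtracting the smaller wealth from the larger ends at equal wealths, since both stay positive.
-/
theorem exists_littleJohnThermograph (a b : ℕ) (ha : 0 < a) (hb : 0 < b) :
    ∃ C, ∀ n, C ≤ n → LittleJohnThermograph a b C n := by
  rcases lt_trichotomy a b with hab | rfl | hab
  · obtain ⟨c, rfl⟩ := Nat.exists_eq_add_of_le hab.le
    obtain ⟨C, h⟩ := exists_littleJohnThermograph a c ha (by omega)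
    exact ⟨_, fun n hn => littleJohnThermograph_add_right ha (by omega) h hn⟩
  · exact ⟨a + 1, fun n hn => littleJohnThermograph_self ha hn⟩
  · obtain ⟨c, rfl⟩ := Nat.exists_eq_add_of_le hab.le
    obtain ⟨C, h⟩ := exists_littleJohnThermograph c b (by omega) hb
    exact ⟨_, fun n hn => littleJohnThermograph_add_left hb (by omega) h hn⟩
termination_by a + b

theorem mainTheorem4 (a b : ℕ) (ha : 0 < a) (hb : 0 < b) :
    ∃ N : ℕ, ∀ n : ℕ, N ≤ n →
      (Real.goldenRatio < (a : ℝ) / b → (littleJohn n a b).IsLeftSingleTent) ∧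
      ((a : ℝ) / b < Real.goldenRatio⁻¹ → (littleJohn n a b).IsRightSingleTent) ∧
      (¬ Real.goldenRatio < (a : ℝ) / b → ¬ (a : ℝ) / b < Real.goldenRatio⁻¹ →
        (littleJohn n a b).IsDoubleTent) := by
  rw [goldenRatio_lt_div_iff hb, div_lt_inv_goldenRatio_iff ha hb]
  obtain ⟨C, h⟩ := exists_littleJohnThermograph a b ha hb
  refine ⟨C, fun n hn => ?_⟩
  obtain ⟨h₁, h₂, h₃⟩ := h n hn
  refine ⟨fun hab => ?_, fun hab => ?_, fun hab hab' => ?_⟩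
  · obtain ⟨t, -, -, ht⟩ := h₁ hab
    exact ht.isLeftSingleTent
  · obtain ⟨t, -, -, ht⟩ := h₂ hab
    exact ht.isRightSingleTent
  · obtain ⟨l, r, t, -, -, -, -, ht⟩ := h₃ hab hab'
    exact ht.isDoubleTent
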